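/- Let $p,q\ge 2$ be integers with $(p,q)\ne(2,2)$, and let $M=S^{p-1}\times S^{q-1}$ be equipped with the pseudo-Riemannian metric $g_{S^{p-1}}\oplus(-g_{S^{q-1}})$ and the standard measure $d\omega$ (the product of the surface measures). Let $$\widetilde\Delta_M=\Delta_{S^{p-1}}-\Delta_{S^{q-1}}-\frac{p+q-4}{4(p+q-3)}\bigl((p-1)(p-2)-(q-1)(q-2)\bigr)$$ be the Yamabe operator of $M$, and $V^{p,q}=\{f\in C^\infty(M): \widetilde\Delta_M f=0\}$ (complex-valued functions). For $k\in\mathbb N=\{0,1,2,\dots\}$ let $\mathcal H^k(\mathbb R^p)=\{f\in C^\infty(S^{p-1}):\Delta_{S^{p-1}}f=-k(k+p-2)f\}$. Let $P_a$ be the orthogonal projection of $L^2(M)$ onto $\mathcal H^a(\mathbb R^p)\boxtimes L^2(S^{q-1})$, let $Q_b$ be the orthogonal projection onto $L^2(S^{p-1})\boxtimes\mathcal H^b(\mathbb R^q)$, and let $F_{a,b}$ denote the orthogonal projection of $F\in L^2(M)$ to $\mathcal H^a(\mathbb R^p)\boxtimes\mathcal H^b(\mathbb R^q)$. Define $$\operatorname{Dom}(D_p)=\Bigl\{F\in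 L^2(M):\sum_{a\in\mathbb N}\bigl(a+\tfrac{p-2}2\bigr)\|P_aF\|_{L^2(M)}^2<\infty\Bigr\},\qquad D_pF=\sum_{a\in\mathbb N}\sqrt{a+\tfrac{p-2}2}\;P_aF,$$ $$\operatorname{Dom}(D_q)=\Bigl\{F\in L^2(M):\sum_{b\in\mathbb N}\bigl(b+\tfrac{q-2}2\bigr)\|Q_bF\|_{L^2(M)}^2<\infty\Bigr\},\qquad D_qF=\sum_{b\in\mathbb N}\sqrt{b+\tfrac{q-2}2}\;Q_bF.$$ Equip $V^{p,q}$ with the inner product $(f_1,f_2)=\int_M (D_pf_1)\,\overline{D_pf_2}\,d\omega$. **Theorem.** $V^{p,q}$ has a Hilbert completion $\overline{V^{p,q}}$ with respect to this inner product. The inclusion $V^{p,q}\subset L^2(M)$ extends to a continuous injective linear map $\overline{V^{p,q}}\to L^2(M)$, and, if $\overline{V^{p,q}}$ is identified with its image, $$\overline{V^{p,q}}=\{f\in\operatorname{Dom}(D_p)\cap\operatorname{Dom}(D_q): D_pf=D_qf\}=\{f\in\operatorname{Dom}(D_p)\cap\operatorname{Dom}(D_q):\widetilde\Delta_Mf=0\},$$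 where $\widetilde\Delta_M f=0$ is meant in the sense of distributions, i.e. $\int_M f\,\widetilde\Delta_M\varphi\,d\omega=0$ for all $\varphi\in C^\infty(M)$. The norm of $\overline{V^{p,q}}$ is given by $\|F\|^2=\frac14\|(D_p+D_q)F\|_{L^2(M)}^2$. Moreover, for every $F\in\overline{V^{p,q}}$, $$F=\sum F_{a,b},\qquad D_pF=\sum\sqrt{a+\tfrac{p-2}2}\;F_{a,b},\qquad \|F\|^2=\sum\bigl(a+\tfrac{p-2}2\bigr)\|F_{a,b}\|_{L^2(M)}^2,$$ where the sums run over all $(a,b)\in\mathbb N\times\mathbb N$ with $a+\frac p2=b+\frac q2$ (and the first two converge in $L^2(M)$). -/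

import Mathlib

noncomputable section

open MeasureTheory InnerProductSpace
open scoped Manifold ContDiff

namespace MinRep

/-! ## The unit spheres and their product -/

/-- The unit sphere `S^{p-1}` in `ℝ^p`. -/
abbrev Sph (p : ℕ) : Type := Metric.sphere (0 : EuclideanSpace ℝ (Fin p)) 1

/-- The manifold `M = S^{p-1} × S^{q-1}`. -/
abbrev M (p q : ℕ) : Type := Sph p × Sph q

instance neZero_of_two_le (p : ℕ) [h : Fact (2 ≤ p)] : NeZero p :=
  ⟨by have := h.out; omega⟩

/-- The dimension count that lets Mathlib put its manifold structure on `S^{p-1}`. -/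
instance finrank_fact (p : ℕ) [NeZero p] :
    Fact (Module.finrank ℝ (EuclideanSpace ℝ (Fin p)) = (p - 1) + 1) :=
  ⟨by
    have := NeZero.ne p
    simp only [finrank_euclideanSpace, Fintype.card_fin]
    omega⟩

/-- The standard surface measure on `S^{p-1}`. -/
abbrev surf (p : ℕ) : Measure (Sph p) :=
  (volume : Measure (EuclideanSpace ℝ (Fin p))).toSphere

/-- The standard measure on `M = S^{p-1} × S^{q-1}`. -/
abbrev vol (p q : ℕ) : Measure (M p q) := (surf p).prod (surf q)

/-- The complex Hilbert space `L²(M)`. -/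
abbrev L2M (p q : ℕ) : Type := Lp ℂ 2 (vol p q)

/-- The class in `L²(M)` of a continuous function on `M`. -/
def toL2 (p q : ℕ) : C(M p q, ℂ) →L[ℂ] L2M p q :=
  ContinuousMap.toLp 2 (vol p q) ℂ

/-- `f ∈ C^∞(S^{p-1})`. -/
def SmoothSph (p : ℕ) [NeZero p] (f : Sph p → ℂ) : Prop :=
  ContMDiff (𝓡 (p - 1)) 𝓘(ℝ, ℂ) ∞ f

/-- `f ∈ C^∞(M)`. -/
def SmoothM (p q : ℕ) [NeZero p] [NeZero q] (f : M p q → ℂ) : Prop :=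
  ContMDiff ((𝓡 (p - 1)).prod (𝓡 (q - 1))) 𝓘(ℝ, ℂ) ∞ f

/-! ## The Laplace-Beltrami operators and the Yamabe operator -/

/-- The extension `z ↦ f (z / |z|)` of a function on the sphere, homogeneous of degree `0`
(with the irrelevant value `0` at the origin). -/
def radialExt {p : ℕ} (f : Sph p → ℂ) (z : EuclideanSpace ℝ (Fin p)) : ℂ :=
  if h : z ≠ 0 then f ⟨‖z‖⁻¹ • z, by simp [norm_smul, h]⟩ else 0

/-- The Laplace-Beltrami operator of the round unit sphere `S^{p-1}` (with nonpositive spectrum):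
the restriction to the sphere of the Euclidean Laplacian of the degree `0` extension. -/
def sphLaplacian {p : ℕ} (f : Sph p → ℂ) (x : Sph p) : ℂ :=
  Laplacian.laplacian (radialExt f) (x : EuclideanSpace ℝ (Fin p))

/-- `Δ_{S^{p-1}}` acting on functions on `M` in the first variable. -/
def lapFst {p q : ℕ} (f : M p q → ℂ) (z : M p q) : ℂ :=
  sphLaplacian (fun x => f (x, z.2)) z.1

/-- `Δ_{S^{q-1}}` acting on functions on `M` in the second variable. -/
def lapSnd {p q : ℕ} (f : M p q → ℂ) (z : M p q) : ℂ :=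
  sphLaplacian (fun y => f (z.1, y)) z.2

/-- The (constant) scalar curvature of `M` for the metric `g_{S^{p-1}} ⊕ (-g_{S^{q-1}})`;
the sphere `S^n` has scalar curvature `n (n - 1)`. -/
def scalarCurvature (p q : ℕ) : ℝ :=
  ((p : ℝ) - 1) * ((p : ℝ) - 2) - ((q : ℝ) - 1) * ((q : ℝ) - 2)

/-- The Yamabe operator `Δ_M - (n - 2) / (4 (n - 1)) K_M` of `M` for the metric
`g_{S^{p-1}} ⊕ (-g_{S^{q-1}})`; here `n = p + q - 2` is the dimension of `M`, and
`Δ_M = Δ_{S^{p-1}} - Δ_{S^{q-1}}`. -/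
def yamabe {p q : ℕ} (f : M p q → ℂ) (z : M p q) : ℂ :=
  (lapFst f z - lapSnd f z)
    - (((((p : ℝ) + q - 2) - 2) / (4 * (((p : ℝ) + q - 2) - 1)) * scalarCurvature p q : ℝ) : ℂ)
      * f z

/-! Smoothness of the degree `0` extension, and linearity of the operators. -/

theorem contDiffAt_radialExt {p : ℕ} [NeZero p] {f : Sph p → ℂ} (hf : SmoothSph p f)
    {z : EuclideanSpace ℝ (Fin p)} (hz : z ≠ 0) : ContDiffAt ℝ ∞ (radialExt f) z := by
  let U : TopologicalSpace.Opens (EuclideanSpace ℝ (Fin p)) := ⟨{0}ᶜ, isOpen_compl_singleton⟩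
  have hU : ∀ u : U, (u : EuclideanSpace ℝ (Fin p)) ≠ 0 := fun u => u.2
  have hn : ContMDiff 𝓘(ℝ, EuclideanSpace ℝ (Fin p)) 𝓘(ℝ, EuclideanSpace ℝ (Fin p)) ∞
      (fun u : U => ‖(u : EuclideanSpace ℝ (Fin p))‖⁻¹ • (u : EuclideanSpace ℝ (Fin p))) := by
    intro u
    refine (contMDiffAt_subtype_iff (I := 𝓘(ℝ, EuclideanSpace ℝ (Fin p)))
      (f := fun w : EuclideanSpace ℝ (Fin p) => ‖w‖⁻¹ • w)).2 ?_
    rw [contMDiffAt_iff_contDiffAt]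
    exact ((contDiffAt_norm ℝ (hU u)).inv (norm_ne_zero_iff.2 (hU u))).smul contDiffAt_id
  have hs := ContMDiff.codRestrict_sphere (n := p - 1) hn
    (fun u => by simp [norm_smul, hU u])
  have hc : ContMDiff 𝓘(ℝ, EuclideanSpace ℝ (Fin p)) 𝓘(ℝ, ℂ) ∞
      (fun u : U => radialExt f (u : EuclideanSpace ℝ (Fin p))) := by
    convert hf.comp hs using 1
    funext u
    simp only [radialExt, dif_pos (hU u), Function.comp]
    rfl
  rw [← contMDiffAt_iff_contDiffAt]
  exact (contMDiffAt_subtype_iff (U := U) (x := ⟨z, hz⟩)).1 (hc ⟨z, hz⟩)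

theorem radialExt_add {p : ℕ} (f g : Sph p → ℂ) :
    radialExt (f + g) = radialExt f + radialExt g := by
  funext z
  by_cases h : z = 0 <;> simp [radialExt, h]

theorem radialExt_smul {p : ℕ} (c : ℂ) (f : Sph p → ℂ) :
    radialExt (c • f) = c • radialExt f := by
  funext z
  by_cases h : z = 0 <;> simp [radialExt, h]

theorem sph_ne_zero {p : ℕ} (x : Sph p) : (x : EuclideanSpace ℝ (Fin p)) ≠ 0 :=
  ne_zero_of_mem_unit_sphere x

theorem two_le_infty : (2 : ℕ∞ω) ≤ ∞ := by
  exact WithTop.coe_le_coe.2 (le_top : (2 : ℕ∞) ≤ ⊤)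

theorem sphLaplacian_add {p : ℕ} [NeZero p] {f g : Sph p → ℂ} (hf : SmoothSph p f)
    (hg : SmoothSph p g) (x : Sph p) :
    sphLaplacian (f + g) x = sphLaplacian f x + sphLaplacian g x := by
  unfold sphLaplacian
  rw [radialExt_add]
  exact ((contDiffAt_radialExt hf (sph_ne_zero x)).of_le two_le_infty).laplacian_add
    ((contDiffAt_radialExt hg (sph_ne_zero x)).of_le two_le_infty)

theorem sphLaplacian_smul {p : ℕ} [NeZero p] (c : ℂ) {f : Sph p → ℂ} (hf : SmoothSph p f)
    (x : Sph p) : sphLaplacian (c • f) x = c * sphLaplacian f x := by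
  unfold sphLaplacian
  rw [radialExt_smul]
  exact laplacian_smul c
    ((contDiffAt_radialExt hf (sph_ne_zero x)).of_le two_le_infty)

theorem SmoothM.slice_fst {p q : ℕ} [NeZero p] [NeZero q] {f : M p q → ℂ}
    (hf : SmoothM p q f) (y : Sph q) : SmoothSph p (fun x => f (x, y)) :=
  ContMDiff.comp hf (contMDiff_id.prodMk contMDiff_const)

theorem SmoothM.slice_snd {p q : ℕ} [NeZero p] [NeZero q] {f : M p q → ℂ}
    (hf : SmoothM p q f) (x : Sph p) : SmoothSph q (fun y => f (x, y)) :=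
  ContMDiff.comp hf (contMDiff_const.prodMk contMDiff_id)

theorem yamabe_add {p q : ℕ} [NeZero p] [NeZero q] {f g : M p q → ℂ} (hf : SmoothM p q f)
    (hg : SmoothM p q g) (z : M p q) : yamabe (f + g) z = yamabe f z + yamabe g z := by
  have h1 := sphLaplacian_add (hf.slice_fst z.2) (hg.slice_fst z.2) z.1
  have h2 := sphLaplacian_add (hf.slice_snd z.1) (hg.slice_snd z.1) z.2
  unfold yamabe lapFst lapSnd
  change sphLaplacian ((fun x => f (x, z.2)) + fun x => g (x, z.2)) z.1
    - sphLaplacian ((fun y => f (z.1, y)) + fun y => g (z.1, y)) z.2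
    - _ * (f z + g z) = _
  rw [h1, h2]
  ring

theorem yamabe_smul {p q : ℕ} [NeZero p] [NeZero q] (c : ℂ) {f : M p q → ℂ}
    (hf : SmoothM p q f) (z : M p q) : yamabe (c • f) z = c * yamabe f z := by
  have h1 := sphLaplacian_smul c (hf.slice_fst z.2) z.1
  have h2 := sphLaplacian_smul c (hf.slice_snd z.1) z.2
  unfold yamabe lapFst lapSnd
  change sphLaplacian (c • fun x => f (x, z.2)) z.1
    - sphLaplacian (c • fun y => f (z.1, y)) z.2
    - _ * (c * f z) = _
  rw [h1, h2]
  ring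

/-! ## The space `V^{p,q}` and spherical harmonics -/

/-- `V^{p,q} = {f ∈ C^∞(M) | Δ̃_M f = 0}`. -/
def V (p q : ℕ) [NeZero p] [NeZero q] : Submodule ℂ C(M p q, ℂ) where
  carrier := {f | SmoothM p q f ∧ ∀ z, yamabe f z = 0}
  zero_mem' := by
    have h0 : SmoothM p q (0 : M p q → ℂ) := contMDiff_const
    refine ⟨h0, fun z => ?_⟩
    have := yamabe_smul 0 h0 z
    rw [zero_smul, zero_mul] at this
    exact this
  add_mem' := by
    rintro f g ⟨hf, hf'⟩ ⟨hg, hg'⟩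
    refine ⟨ContMDiff.add hf hg, fun z => ?_⟩
    rw [ContinuousMap.coe_add, yamabe_add hf hg, hf', hg', add_zero]
  smul_mem' := by
    rintro c f ⟨hf, hf'⟩
    have hc : SmoothM p q (c • (f : M p q → ℂ)) :=
      (contDiff_const_smul (𝕜 := ℝ) (F := ℂ) c).comp_contMDiff hf
    refine ⟨hc, fun z => ?_⟩
    rw [ContinuousMap.coe_smul, yamabe_smul c hf, hf', mul_zero]

/-- The space `H^k(ℝ^p)` of spherical harmonics of degree `k`:
smooth `f` on `S^{p-1}` with `Δ_{S^{p-1}} f = - k (k + p - 2) f`. -/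
def harmonics (p : ℕ) [NeZero p] (k : ℕ) : Set C(Sph p, ℂ) :=
  {f | SmoothSph p f ∧
    ∀ x, sphLaplacian f x = -((k : ℂ) * ((k : ℂ) + (p : ℂ) - 2)) * f x}

/-- `H^a(ℝ^p) ⊠ L²(S^{q-1})` as a closed subspace of `L²(M)`. -/
def compFst (p q : ℕ) [NeZero p] (a : ℕ) : Submodule ℂ (L2M p q) :=
  (Submodule.span ℂ {F : L2M p q | ∃ Y ∈ harmonics p a, ∃ g : Lp ℂ 2 (surf q),
    F =ᵐ[vol p q] fun z => Y z.1 * g z.2}).topologicalClosure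

/-- `L²(S^{p-1}) ⊠ H^b(ℝ^q)` as a closed subspace of `L²(M)`. -/
def compSnd (p q : ℕ) [NeZero q] (b : ℕ) : Submodule ℂ (L2M p q) :=
  (Submodule.span ℂ {F : L2M p q | ∃ g : Lp ℂ 2 (surf p), ∃ Z ∈ harmonics q b,
    F =ᵐ[vol p q] fun z => g z.1 * Z z.2}).topologicalClosure

/-- The `K`-type `H^a(ℝ^p) ⊠ H^b(ℝ^q)` as a closed subspace of `L²(M)`. -/
def kType (p q : ℕ) [NeZero p] [NeZero q] (a b : ℕ) : Submodule ℂ (L2M p q) :=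
  (Submodule.span ℂ {F : L2M p q | ∃ Y ∈ harmonics p a, ∃ Z ∈ harmonics q b,
    F =ᵐ[vol p q] fun z => Y z.1 * Z z.2}).topologicalClosure

instance (p q : ℕ) [NeZero p] (a : ℕ) : CompleteSpace (compFst p q a) :=
  inferInstanceAs (CompleteSpace (Submodule.topologicalClosure _))

instance (p q : ℕ) [NeZero q] (b : ℕ) : CompleteSpace (compSnd p q b) :=
  inferInstanceAs (CompleteSpace (Submodule.topologicalClosure _))

instance (p q : ℕ) [NeZero p] [NeZero q] (a b : ℕ) : CompleteSpace (kType p q a b) :=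
  inferInstanceAs (CompleteSpace (Submodule.topologicalClosure _))

/-- The component `F_{a,b}` of `F ∈ L²(M)` in `H^a(ℝ^p) ⊠ H^b(ℝ^q)` (orthogonal projection). -/
def kComp {p q : ℕ} [NeZero p] [NeZero q] (a b : ℕ) (F : L2M p q) : L2M p q :=
  (kType p q a b).starProjection F

/-! ## The operators `D_p` and `D_q` on `L²(M)` -/

/-- The eigenvalue `a + (p - 2) / 2` of `D_p²` on `H^a(ℝ^p) ⊠ L²(S^{q-1})`. -/
def eigval (p a : ℕ) : ℝ := (a : ℝ) + ((p : ℝ) - 2) / 2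

/-- The domain of `D_p`. -/
def domDp (p q : ℕ) [NeZero p] : Set (L2M p q) :=
  {F | Summable fun a : ℕ => eigval p a * ‖(compFst p q a).starProjection F‖ ^ 2}

/-- The domain of `D_q`. -/
def domDq (p q : ℕ) [NeZero q] : Set (L2M p q) :=
  {F | Summable fun b : ℕ => eigval q b * ‖(compSnd p q b).starProjection F‖ ^ 2}

/-- `D_p = (-Δ_{S^{p-1}} + (p - 2)² / 4)^{1/4}`, which acts on `H^a(ℝ^p) ⊠ L²(S^{q-1})` as the
scalar `√(a + (p - 2) / 2)`. The sum converges in `L²(M)` for `F` in the domain; the value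
outside of the domain is irrelevant. -/
def Dp {p q : ℕ} [NeZero p] (F : L2M p q) : L2M p q :=
  ∑' a : ℕ, ((Real.sqrt (eigval p a) : ℝ) : ℂ) • (compFst p q a).starProjection F

/-- `D_q = (-Δ_{S^{q-1}} + (q - 2)² / 4)^{1/4}`, which acts on `L²(S^{p-1}) ⊠ H^b(ℝ^q)` as the
scalar `√(b + (q - 2) / 2)`. -/
def Dq {p q : ℕ} [NeZero q] (F : L2M p q) : L2M p q :=
  ∑' b : ℕ, ((Real.sqrt (eigval q b) : ℝ) : ℂ) • (compSnd p q b).starProjection F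

/-- `Δ̃_M F = 0` in the sense of distributions on `M` (`Δ̃_M` is formally symmetric). -/
def WeakYamabeZero {p q : ℕ} [NeZero p] [NeZero q] (F : L2M p q) : Prop :=
  ∀ φ : M p q → ℂ, SmoothM p q φ → ∫ z, F z * yamabe φ z ∂(vol p q) = 0

/-! ## The unitary inner product and the Hilbert completion -/

/-- The inner product `(f₁, f₂) = ∫_M (D_p f₁) (conj (D_p f₂)) dω` on `V^{p,q}`
(linear in `f₁`). -/
def unitaryForm (p q : ℕ) [NeZero p] [NeZero q] (f₁ f₂ : V p q) : ℂ :=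
  ∫ z, (Dp (toL2 p q f₁) : M p q → ℂ) z
    * (starRingEnd ℂ) ((Dp (toL2 p q f₂) : M p q → ℂ) z) ∂(vol p q)

/-- `ι : W → H` exhibits the Hilbert space `H` as the Hilbert completion of the complex vector
space `W` with respect to the inner product `B` (linear in its first argument). -/
structure IsHilbertCompletion {W H : Type*} [AddCommGroup W] [Module ℂ W]
    [NormedAddCommGroup H] [InnerProductSpace ℂ H] (B : W → W → ℂ) (ι : W →ₗ[ℂ] H) : Prop where
  complete : CompleteSpace H
  dense : DenseRange ι
  inner_eq : ∀ f g : W, inner ℂ (ι g) (ι f) = B f g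

end MinRep

end

noncomputable section

open MeasureTheory InnerProductSpace
open scoped Manifold ContDiff

namespace MinRep

/-! ## Orthogonal decompositions of Hilbert spaces -/

section Decomposition

variable {E : Type*} [NormedAddCommGroup E] [InnerProductSpace ℂ E]
  {κ : Type*} {K : κ → Submodule ℂ E}

/-! Everything is diagonal with respect to the K-types `H^a ⊠ H^b`. Write `λ_a = a + (p-2)/2` and
`μ_b = b + (q-2)/2`. The K-types are pairwise orthogonal (Green's formula on each sphere, with
distinct eigenvalues for distinct degrees) and span a dense subspace of `L²(M)` (Stone–Weierstrass,
with every polynomial restricted to a sphere being a sum of harmonics). So a vector is determined by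
its components, and on the `(a, b)` component `D_p` acts as `√λ_a`, `D_q` as `√μ_b` and the Yamabe
operator as `μ_b² - λ_a²`.

Since `λ_a, μ_b ≥ 0`, the equation `D_p F = D_q F` and the weak Yamabe equation both say that
`F_{a,b} = 0` unless `λ_a = μ_b`, that is `2a + p = 2b + q`. On vectors supported on this diagonal
`D_p` and `D_q` agree, domains included, which gives the formula with `1/4`.

It remains to identify the completion of `V` with the vectors of `Dom(D_p)` supported on the
diagonal. Smooth functions lie in `Dom(D_p)` because their Laplacian is again in `L²`. If `(p, q) ≠
(2, 2)`, then `λ_a ≥ 1/2` on the diagonal, so the norm of `D_p f` dominates the `L²` norm of `f`,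
and both the inclusion and `D_p` extend to the completion. The extension of `D_p` is an isometry
with closed range; this range contains every diagonal K-type, because `V` contains the products of
harmonics that generate it. Dividing by `√λ_a` on each component recovers `F` from `D_p F`. The
abstract form is `exists_embedding_of_isHilbertCompletion`. -/

theorem orthogonalFamily_of_pairwise_isOrtho (hK : Pairwise fun i j => K i ⟂ K j) :
    OrthogonalFamily ℂ (fun k => K k) fun k => (K k).subtypeₗᵢ :=
  OrthogonalFamily.of_pairwise hK

theorem summable_of_pairwise_isOrtho [CompleteSpace E] (hK : Pairwise fun i j => K i ⟂ K j) {f : κ → E}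
    (hf : ∀ k, f k ∈ K k) (h : Summable fun k => ‖f k‖ ^ 2) : Summable f :=
  ((orthogonalFamily_of_pairwise_isOrtho hK).summable_iff_norm_sq_summable
    fun k => ⟨f k, hf k⟩).2 h

variable [∀ k, (K k).HasOrthogonalProjection]

theorem starProjection_of_isOrtho {U U' : Submodule ℂ E} [U.HasOrthogonalProjection]
    (h : U ⟂ U') {x : E} (hx : x ∈ U') : U.starProjection x = 0 :=
  (Submodule.starProjection_apply_eq_zero_iff U).2 (h.symm hx)

theorem starProjection_sum_of_pairwise_isOrtho (hK : Pairwise fun i j => K i ⟂ K j) {f : κ → E}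
    (hf : ∀ k, f k ∈ K k) {x : E} (h : HasSum f x) (k : κ) : (K k).starProjection x = f k := by
  have h1 := (h.mapL (K k).starProjection)
  have h2 : HasSum (fun i => (K k).starProjection (f i)) (f k) := by
    convert hasSum_single k fun i hi => starProjection_of_isOrtho (hK hi.symm) (hf i) using 1
    exact (Submodule.starProjection_eq_self_iff.2 (hf k)).symm
  exact h1.unique h2

/-- The difference `x - y` is orthogonal to each `K k`, hence to a dense subspace, hence to itself.
-/
theorem eq_of_starProjection_eq (hd : (⨆ k, K k).topologicalClosure = ⊤) {x y : E}
    (h : ∀ k, (K k).starProjection x = (K k).starProjection y) : x = y := by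
  have h1 : (⨆ k, K k) ≤ (Submodule.span ℂ {x - y})ᗮ := by
    refine iSup_le fun k => ?_
    have : x - y ∈ (K k)ᗮ := by
      rw [← Submodule.starProjection_apply_eq_zero_iff, map_sub, h k, sub_self]
    rw [Submodule.le_orthogonal_iff_le_orthogonal]
    simpa [Submodule.span_le] using this
  have h2 := Submodule.topologicalClosure_minimal _ h1 (Submodule.isClosed_orthogonal _)
  rw [hd] at h2
  have h3 : x - y ∈ (Submodule.span ℂ {x - y})ᗮ := h2 trivial
  have h4 := Submodule.inner_right_of_mem_orthogonal (Submodule.mem_span_singleton_self _) h3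
  exact sub_eq_zero.1 (inner_self_eq_zero.1 h4)

/-- Bessel's inequality: the partial sum `s` of the projections satisfies `‖s‖² = re ⟪s, x⟫ ≤ ‖s‖
‖x‖`. -/
theorem sum_norm_sq_starProjection_le (hK : Pairwise fun i j => K i ⟂ K j) (x : E)
    (s : Finset κ) : ∑ k ∈ s, ‖(K k).starProjection x‖ ^ 2 ≤ ‖x‖ ^ 2 := by
  have h1 := (orthogonalFamily_of_pairwise_isOrtho hK).norm_sum
    (fun k => (K k).orthogonalProjectionOnto x) s
  simp only [Submodule.coe_subtypeₗᵢ, Submodule.subtype_apply] at h1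
  have h1' : ‖∑ k ∈ s, (K k).starProjection x‖ ^ 2
      = ∑ k ∈ s, ‖(K k).starProjection x‖ ^ 2 := h1
  have h2 : RCLike.re (inner ℂ (∑ k ∈ s, (K k).starProjection x) x)
      = ∑ k ∈ s, ‖(K k).starProjection x‖ ^ 2 := by
    rw [sum_inner, map_sum]
    refine Finset.sum_congr rfl fun k _ => ?_
    exact Submodule.re_inner_starProjection_eq_normSq _ _
  have h3 := (RCLike.re_le_norm _).trans (norm_inner_le_norm (𝕜 := ℂ)
    (∑ k ∈ s, (K k).starProjection x) x)
  rw [h2, ← h1'] at h3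
  rw [← h1']
  nlinarith [norm_nonneg x, norm_nonneg (∑ k ∈ s, (K k).starProjection x)]

theorem summable_norm_sq_starProjection (hK : Pairwise fun i j => K i ⟂ K j) (x : E) :
    Summable fun k => ‖(K k).starProjection x‖ ^ 2 :=
  summable_of_sum_le (fun _ => sq_nonneg _) (sum_norm_sq_starProjection_le hK x)

variable [CompleteSpace E]

/-- Bessel's inequality makes the series converge, and its sum has the same components as `x`. -/
theorem hasSum_starProjection (hK : Pairwise fun i j => K i ⟂ K j)
    (hd : (⨆ k, K k).topologicalClosure = ⊤) (x : E) :
    HasSum (fun k => (K k).starProjection x) x := by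
  have hm : ∀ k, (K k).starProjection x ∈ K k := fun k => Submodule.starProjection_apply_mem _ _
  have hs := (summable_of_pairwise_isOrtho hK hm (summable_norm_sq_starProjection hK x)).hasSum
  convert hs using 1
  exact eq_of_starProjection_eq hd fun k =>
    (starProjection_sum_of_pairwise_isOrtho hK hm hs k).symm

theorem hasSum_norm_sq_starProjection (hK : Pairwise fun i j => K i ⟂ K j)
    (hd : (⨆ k, K k).topologicalClosure = ⊤) (x : E) :
    HasSum (fun k => ‖(K k).starProjection x‖ ^ 2) (‖x‖ ^ 2) := by
  have h1 : HasSum (fun k => (inner ℂ x ((K k).starProjection x)).re) (inner ℂ x x).re :=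
    Complex.hasSum_re ((hasSum_starProjection hK hd x).mapL (innerSL ℂ x))
  convert h1 using 1
  · funext k
    exact ((inner_re_symm x _).trans (Submodule.re_inner_starProjection_eq_normSq _ _)).symm
  · exact (inner_self_eq_norm_sq (𝕜 := ℂ) x).symm

end Decomposition

/-! ## Diagonal operators -/

section Diagonal

variable {E : Type*} [NormedAddCommGroup E] [InnerProductSpace ℂ E]

/-- The domain of the operator acting on `P a` as the scalar `√(α a)`. -/
def diagDom (α : ℕ → ℝ) (P : ℕ → Submodule ℂ E) [∀ a, (P a).HasOrthogonalProjection] : Set E :=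
  {F | Summable fun a => α a * ‖(P a).starProjection F‖ ^ 2}

/-- The operator acting on `P a` as the scalar `√(α a)`. -/
def diagOp (α : ℕ → ℝ) (P : ℕ → Submodule ℂ E) [∀ a, (P a).HasOrthogonalProjection] (F : E) : E :=
  ∑' a, ((Real.sqrt (α a) : ℝ) : ℂ) • (P a).starProjection F

variable {κ : Type*} {K : κ → Submodule ℂ E} [∀ k, (K k).HasOrthogonalProjection]
  {P : ℕ → Submodule ℂ E} [∀ a, (P a).HasOrthogonalProjection] {π : κ → ℕ} {α : ℕ → ℝ}

theorem starProjection_starProjection_coarse (hP : Pairwise fun i j => P i ⟂ P j)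
    (hKP : ∀ k, K k ≤ P (π k)) (k : κ) (a : ℕ) (x : E) :
    (K k).starProjection ((P a).starProjection x)
      = if π k = a then (K k).starProjection x else 0 := by
  split_ifs with h
  · subst h
    have := Submodule.starProjection_comp_starProjection_of_le (hKP k)
    exact congrArg (fun T => T x) this
  · exact starProjection_of_isOrtho ((hP h).mono_left (hKP k))
      (Submodule.starProjection_apply_mem _ _)

/-- The decomposition `K` refines `P` along `π`, so a scalar relation on the fine components that
depends only on `π k` passes to the coarse ones. This lets `D_p` and `D_q` be studied on one common
family of K-types. -/
theorem starProjection_coarse_eq (hP : Pairwise fun i j => P i ⟂ P j)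
    (hKP : ∀ k, K k ≤ P (π k)) (hd : (⨆ k, K k).topologicalClosure = ⊤) {c : ℕ → ℂ} {F G : E}
    (h : ∀ k, (K k).starProjection G = c (π k) • (K k).starProjection F) (a : ℕ) :
    (P a).starProjection G = c a • (P a).starProjection F := by
  refine eq_of_starProjection_eq hd fun k => ?_
  rw [map_smul, starProjection_starProjection_coarse hP hKP,
    starProjection_starProjection_coarse hP hKP]
  split_ifs with hk
  · rw [h, hk]
  · rw [smul_zero]

variable [CompleteSpace E]

/-- Membership in the domain is what makes the defining series summable, so that `tsum` is a genuine
sum and a continuous projection may be applied term by term. -/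
theorem starProjection_diagOp (hP : Pairwise fun i j => P i ⟂ P j)
    (hKP : ∀ k, K k ≤ P (π k)) (hα : ∀ a, 0 ≤ α a) {F : E} (hF : F ∈ diagDom α P) (k : κ) :
    (K k).starProjection (diagOp α P F)
      = ((Real.sqrt (α (π k)) : ℝ) : ℂ) • (K k).starProjection F := by
  have hs : Summable fun a => ((Real.sqrt (α a) : ℝ) : ℂ) • (P a).starProjection F := by
    refine summable_of_pairwise_isOrtho hP
      (fun a => (P a).smul_mem _ (Submodule.starProjection_apply_mem _ _)) ?_
    refine hF.congr fun a => ?_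
    rw [norm_smul, mul_pow, Complex.norm_real, Real.norm_eq_abs, sq_abs, Real.sq_sqrt (hα a)]
  have h1 := hs.hasSum.mapL (K k).starProjection
  refine h1.unique ?_
  simp only [map_smul, starProjection_starProjection_coarse hP hKP]
  convert hasSum_single (π k) fun a ha => ?_ using 1
  · rw [if_pos rfl]
  · rw [if_neg ha.symm, smul_zero]

/-- The converse of `starProjection_diagOp`: once some `G` in the space has the components expected
of the image of `F`, Bessel's inequality for `G` is the domain condition for `F`. -/
theorem mem_diagDom_and_diagOp_eq (hP : Pairwise fun i j => P i ⟂ P j)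
    (hKP : ∀ k, K k ≤ P (π k)) (hd : (⨆ k, K k).topologicalClosure = ⊤) (hα : ∀ a, 0 ≤ α a)
    {F G : E} (h : ∀ k, (K k).starProjection G
      = ((Real.sqrt (α (π k)) : ℝ) : ℂ) • (K k).starProjection F) :
    F ∈ diagDom α P ∧ diagOp α P F = G := by
  have hF : F ∈ diagDom α P := by
    refine (summable_norm_sq_starProjection hP G).congr fun a => ?_
    rw [starProjection_coarse_eq (c := fun a => ((Real.sqrt (α a) : ℝ) : ℂ)) hP hKP hd h, norm_smul,
      mul_pow, Complex.norm_real, Real.norm_eq_abs, sq_abs, Real.sq_sqrt (hα a)]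
  exact ⟨hF, eq_of_starProjection_eq hd fun k => by
    rw [starProjection_diagOp hP hKP hα hF, h]⟩

end Diagonal

/-! ## The completion with respect to the norm of a diagonal operator -/

section Completion

universe u

variable {E : Type u} [NormedAddCommGroup E] [InnerProductSpace ℂ E] [CompleteSpace E]
  {κ : Type*} {K : κ → Submodule ℂ E} [∀ k, (K k).HasOrthogonalProjection]
  {P : ℕ → Submodule ℂ E} [∀ a, (P a).HasOrthogonalProjection]
  {π : κ → ℕ} {α : ℕ → ℝ} {W : Type*} [AddCommGroup W] [Module ℂ W] {τ : W →ₗ[ℂ] E}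

/-- The operator `diagOp α P` on a vector space mapped into its domain. -/
def diagLinearMap (hP : Pairwise fun i j => P i ⟂ P j)
    (hKP : ∀ k, K k ≤ P (π k)) (hd : (⨆ k, K k).topologicalClosure = ⊤) (hα : ∀ a, 0 ≤ α a)
    (hτ : ∀ f, τ f ∈ diagDom α P) : W →ₗ[ℂ] E where
  toFun f := diagOp α P (τ f)
  map_add' f g := eq_of_starProjection_eq hd fun k => by
    simp only [map_add, starProjection_diagOp hP hKP hα (hτ _)]
    rw [starProjection_diagOp hP hKP hα (by rw [← map_add]; exact hτ _), map_add, smul_add]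
  map_smul' c f := eq_of_starProjection_eq hd fun k => by
    simp only [map_smul, starProjection_diagOp hP hKP hα (hτ _), RingHom.id_apply]
    rw [starProjection_diagOp hP hKP hα (by rw [← map_smul]; exact hτ _), map_smul, smul_comm]

/-- The completion is realised concretely as the closure of the image of `diagOp α P` in `E`, with
the inner product of `E`. -/
theorem exists_isHilbertCompletion (hP : Pairwise fun i j => P i ⟂ P j)
    (hKP : ∀ k, K k ≤ P (π k)) (hd : (⨆ k, K k).topologicalClosure = ⊤) (hα : ∀ a, 0 ≤ α a)
    (hτ : ∀ f, τ f ∈ diagDom α P) {B : W → W → ℂ}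
    (hB : ∀ f g, B f g = inner ℂ (diagOp α P (τ g)) (diagOp α P (τ f))) :
    ∃ (H : Type u) (_ : NormedAddCommGroup H) (_ : InnerProductSpace ℂ H) (ι : W →ₗ[ℂ] H),
      IsHilbertCompletion B ι := by
  set D := diagLinearMap hP hKP hd hα hτ
  refine ⟨(LinearMap.range D).topologicalClosure, inferInstance, inferInstance,
    D.codRestrict _ fun f => Submodule.le_topologicalClosure _ ⟨f, rfl⟩, ?_, ?_, ?_⟩
  · infer_instance
  · rintro ⟨x, hx⟩
    rw [closure_subtype]
    refine closure_mono ?_ hx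
    rintro _ ⟨f, rfl⟩
    exact ⟨_, ⟨f, rfl⟩, rfl⟩
  · intro f g
    exact (hB f g).symm

variable {H : Type*} [NormedAddCommGroup H] [InnerProductSpace ℂ H] {ι : W →ₗ[ℂ] H} {S : Set κ}

/-- The completion of `W` for the norm of `diagOp α P` embeds in the ambient Hilbert space, onto the
vectors of the domain supported on `S`. -/
theorem exists_embedding_of_isHilbertCompletion (hK : Pairwise fun i j => K i ⟂ K j)
    (hP : Pairwise fun i j => P i ⟂ P j)
    (hKP : ∀ k, K k ≤ P (π k)) (hd : (⨆ k, K k).topologicalClosure = ⊤) (hα : ∀ a, 0 ≤ α a)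
    (hτ : ∀ f, τ f ∈ diagDom α P) (hS : ∀ f, ∀ k ∉ S, (K k).starProjection (τ f) = 0)
    (hW : ∀ k ∈ S, K k ≤ (LinearMap.range τ ⊓ K k).topologicalClosure)
    {c : ℝ} (hc : 0 < c) (hcα : ∀ k ∈ S, c ≤ α (π k))
    {B : W → W → ℂ} (hB : ∀ f g, B f g = inner ℂ (diagOp α P (τ g)) (diagOp α P (τ f)))
    (hι : IsHilbertCompletion B ι) :
    ∃ j : H →L[ℂ] E, (∀ f, j (ι f) = τ f) ∧ Function.Injective j ∧
      (∀ h, (∀ k ∉ S, (K k).starProjection (j h) = 0) ∧ j h ∈ diagDom α P ∧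
        ‖diagOp α P (j h)‖ = ‖h‖) ∧
      ∀ F ∈ diagDom α P, (∀ k ∉ S, (K k).starProjection F = 0) → F ∈ Set.range j := by
  have := hι.complete
  set D := diagLinearMap hP hKP hd hα hτ with hD
  have hDk : ∀ f k, (K k).starProjection (D f)
      = ((Real.sqrt (α (π k)) : ℝ) : ℂ) • (K k).starProjection (τ f) := fun f k =>
    starProjection_diagOp hP hKP hα (hτ f) k
  have hDι : ∀ f, ‖D f‖ = ‖ι f‖ := fun f => by
    have h1 : inner ℂ (ι f) (ι f) = inner ℂ (D f) (D f) := (hι.inner_eq f f).trans (hB f f)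
    rw [inner_self_eq_norm_sq_to_K, inner_self_eq_norm_sq_to_K] at h1
    have h2 : ‖ι f‖ ^ 2 = ‖D f‖ ^ 2 := by exact_mod_cast h1
    exact ((sq_eq_sq₀ (norm_nonneg _) (norm_nonneg _)).1 h2).symm
  -- Compare the two Parseval sums termwise: on `S` the multiplier is at least `c`, and off `S` both
  -- terms vanish.
  have hτD : ∀ f, c * ‖τ f‖ ^ 2 ≤ ‖D f‖ ^ 2 := fun f => by
    refine hasSum_le (fun k => ?_) ((hasSum_norm_sq_starProjection hK hd (τ f)).mul_left c)
      (hasSum_norm_sq_starProjection hK hd (D f))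
    rw [hDk, norm_smul, mul_pow, Complex.norm_real, Real.norm_eq_abs, sq_abs, Real.sq_sqrt (hα _)]
    by_cases hk : k ∈ S
    · exact mul_le_mul_of_nonneg_right (hcα k hk) (sq_nonneg _)
    · simp [hS f k hk]
  have hτι : ∀ f, ‖τ f‖ ≤ (Real.sqrt c)⁻¹ * ‖ι f‖ := fun f => by
    rw [← hDι, inv_mul_eq_div, le_div_iff₀ (Real.sqrt_pos.2 hc), mul_comm]
    refine abs_le_of_sq_le_sq' ?_ (norm_nonneg _) |>.2
    rw [mul_pow, Real.sq_sqrt hc.le]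
    exact hτD f
  -- `j` extends the inclusion and `T` extends `D`, both by continuity from the dense image of `ι`.
  -- `T` is isometric, and its components remain `√α` times those of `j`.
  set j := τ.extendOfNorm ι
  set T := D.extendOfNorm ι
  have hj : ∀ f, j (ι f) = τ f := LinearMap.extendOfNorm_eq hι.dense ⟨_, hτι⟩
  have hT : ∀ f, T (ι f) = D f := LinearMap.extendOfNorm_eq hι.dense
    ⟨1, fun f => by rw [one_mul, hDι]⟩
  have hTn : ∀ h, ‖T h‖ = ‖h‖ := fun h =>
    hι.dense.induction (by rintro _ ⟨f, rfl⟩; rw [hT, hDι])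
      (isClosed_eq (by fun_prop) (by fun_prop)) h
  have hjk : ∀ h, ∀ k ∉ S, (K k).starProjection (j h) = 0 := fun h k hk =>
    hι.dense.induction (P := fun h => (K k).starProjection (j h) = 0)
      (by rintro _ ⟨f, rfl⟩; rw [hj, hS f k hk])
      (isClosed_eq (by fun_prop) (by fun_prop)) h
  have hTk : ∀ h k, (K k).starProjection (T h)
      = ((Real.sqrt (α (π k)) : ℝ) : ℂ) • (K k).starProjection (j h) := fun h k =>
    hι.dense.induction (P := fun h => (K k).starProjection (T h)
      = ((Real.sqrt (α (π k)) : ℝ) : ℂ) • (K k).starProjection (j h))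
      (by rintro _ ⟨f, rfl⟩; rw [hj, hT, hDk])
      (isClosed_eq (by fun_prop) (by fun_prop)) h
  have hjT : ∀ h, j h ∈ diagDom α P ∧ diagOp α P (j h) = T h := fun h =>
    mem_diagDom_and_diagOp_eq hP hKP hd hα (hTk h)
  refine ⟨j, hj, ?_, fun h => ⟨hjk h, (hjT h).1, by rw [(hjT h).2, hTn]⟩, ?_⟩
  · rw [injective_iff_map_eq_zero]
    intro h hh
    have : T h = 0 := eq_of_starProjection_eq hd fun k => by rw [hTk, hh, map_zero, smul_zero]
    rw [← norm_eq_zero, ← hTn, this, norm_zero]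
  · intro F hF hFk
    have hTcl : IsClosed (LinearMap.range (T : H →ₗ[ℂ] E) : Set E) := by
      have : Isometry T := AddMonoidHomClass.isometry_of_norm T hTn
      rw [LinearMap.coe_range]
      exact this.isClosedEmbedding.isClosed_range
    -- By `hW` it suffices to reach `τ f` lying in `K k`. There `T` is multiplication by `√(α (π k))
    -- ≠ 0`, so rescaling `f` gives a preimage.
    have hKT : ∀ k ∈ S, K k ≤ LinearMap.range (T : H →ₗ[ℂ] E) := by
      intro k hk
      refine (hW k hk).trans (Submodule.topologicalClosure_minimal _ ?_ hTcl)
      rintro _ ⟨⟨f, rfl⟩, hf⟩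
      have h0 : ((Real.sqrt (α (π k)) : ℝ) : ℂ) ≠ 0 :=
        Complex.ofReal_ne_zero.2 (Real.sqrt_pos.2 (hc.trans_le (hcα k hk))).ne'
      refine ⟨ι (((Real.sqrt (α (π k)) : ℝ) : ℂ)⁻¹ • f), ?_⟩
      refine eq_of_starProjection_eq hd fun l => ?_
      change (K l).starProjection (T _) = _
      rw [hT, map_smul, map_smul, hDk]
      by_cases hl : l = k
      · subst hl
        rw [smul_smul, inv_mul_cancel₀ h0, one_smul]
      · rw [starProjection_of_isOrtho (hK hl) hf, smul_zero, smul_zero]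
    have hG := starProjection_diagOp hP hKP hα hF (K := K)
    set G := diagOp α P F
    -- `G` is the limit of finite sums of its components, which all lie in the closed range of `T`.
    have hGT : G ∈ LinearMap.range (T : H →ₗ[ℂ] E) := by
      refine hTcl.mem_of_tendsto (hasSum_starProjection hK hd G) (Filter.Eventually.of_forall ?_)
      intro s
      refine Submodule.sum_mem _ fun k _ => ?_
      by_cases hk : k ∈ S
      · exact hKT k hk (Submodule.starProjection_apply_mem _ _)
      · rw [hG, hFk k hk, smul_zero]
        exact Submodule.zero_mem _
    obtain ⟨h, hh⟩ := hGT
    change T h = G at hh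
    -- The components of `T h = G` are `√α` times those of both `j h` and `F`; cancel `√α` on `S`,
    -- while off `S` both components are zero.
    refine ⟨h, eq_of_starProjection_eq hd fun k => ?_⟩
    by_cases hk : k ∈ S
    · have h0 : ((Real.sqrt (α (π k)) : ℝ) : ℂ) ≠ 0 :=
        Complex.ofReal_ne_zero.2 (Real.sqrt_pos.2 (hc.trans_le (hcα k hk))).ne'
      refine smul_right_injective E h0 ?_
      change _ • _ = _ • _
      rw [← hTk, hh, hG]
    · rw [hjk h k hk, hFk k hk]

end Completion

/-! ## Green's formula on the sphere -/

section Green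

variable {p : ℕ}

local notation "𝔼" => EuclideanSpace ℝ (Fin p)

/-- The standard basis of `ℝ^p`. -/
abbrev stdVec (i : Fin p) : EuclideanSpace ℝ (Fin p) := EuclideanSpace.basisFun (Fin p) ℝ i

theorem laplacian_eq_sum_fderiv (F : 𝔼 → ℂ) (z : 𝔼) :
    Laplacian.laplacian F z = ∑ i, fderiv ℝ (fderiv ℝ F) z (stdVec i) (stdVec i) := by
  rw [laplacian_eq_iteratedFDeriv_orthonormalBasis F (EuclideanSpace.basisFun (Fin p) ℝ)]
  simp [iteratedFDeriv_two_apply]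

theorem sum_coord_smul_stdVec (z : 𝔼) : ∑ i, z i • stdVec i = z := by
  simpa using (EuclideanSpace.basisFun (Fin p) ℝ).sum_repr z

theorem radialExt_coe (f : Sph p → ℂ) (x : Sph p) : radialExt f (x : 𝔼) = f x := by
  have hx : ‖(x : 𝔼)‖ = 1 := by simp
  rw [radialExt, dif_pos (sph_ne_zero x)]
  congr 1
  ext1
  simp

theorem radialExt_smul_arg (f : Sph p → ℂ) {c : ℝ} (hc : 0 < c) (z : 𝔼) :
    radialExt f (c • z) = radialExt f z := by
  by_cases h : z = 0
  · simp [h]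
  · rw [radialExt, radialExt, dif_pos h, dif_pos (smul_ne_zero hc.ne' h)]
    congr 2
    rw [norm_smul, Real.norm_of_nonneg hc.le, smul_smul]
    congr 1
    field_simp

theorem radialExt_smul_coe (f : Sph p → ℂ) {c : ℝ} (hc : 0 < c) (x : Sph p) :
    radialExt f (c • (x : 𝔼)) = f x := by
  rw [radialExt_smul_arg f hc, radialExt_coe]

/-- Differentiating twice a function homogeneous of degree `0` lowers the degree to `-2`. -/
theorem laplacian_radialExt_smul (f : Sph p → ℂ) {c : ℝ} (hc : 0 < c) (x : Sph p) :
    Laplacian.laplacian (radialExt f) (c • (x : 𝔼)) = ((c ^ 2)⁻¹ : ℝ) * sphLaplacian f x := by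
  have h1 : fderiv ℝ (radialExt f) = fun z => c • fderiv ℝ (radialExt f) (c • z) := by
    funext z
    rw [← fderiv_comp_smul]
    congr 1
    funext w
    exact (radialExt_smul_arg f hc w).symm
  have h2 : fderiv ℝ (fderiv ℝ (radialExt f)) (x : 𝔼)
      = c • c • fderiv ℝ (fderiv ℝ (radialExt f)) (c • (x : 𝔼)) := by
    conv_lhs => rw [h1]
    refine (congrFun (fderiv_const_smul_field (𝕜 := ℝ)
      (f := fun z : 𝔼 => fderiv ℝ (radialExt f) (c • z)) c) (x : 𝔼)).trans ?_
    rw [Pi.smul_apply, fderiv_comp_smul]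
  rw [sphLaplacian, laplacian_eq_sum_fderiv, laplacian_eq_sum_fderiv, h2]
  simp only [smul_apply, Complex.real_smul, Finset.mul_sum]
  refine Finset.sum_congr rfl fun i _ => ?_
  have : (c : ℂ) ≠ 0 := Complex.ofReal_ne_zero.2 hc.ne'
  push_cast
  field_simp

/-- The extension is constant along rays, so its radial derivative vanishes. -/
theorem fderiv_radialExt_self [NeZero p] {f : Sph p → ℂ} (hf : SmoothSph p f) {z : 𝔼}
    (hz : z ≠ 0) : fderiv ℝ (radialExt f) z z = 0 := by
  have h1 : HasFDerivAt (radialExt f) (fderiv ℝ (radialExt f) z) ((1 : ℝ) • z) := by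
    rw [one_smul]
    exact ((contDiffAt_radialExt hf hz).differentiableAt (by simp)).hasFDerivAt
  have h2 : HasDerivAt (fun t : ℝ => t • z) ((1 : ℝ) • z) 1 := (hasDerivAt_id 1).smul_const z
  have h3 := h1.comp_hasDerivAt 1 h2
  rw [one_smul] at h3
  refine h3.unique ((hasDerivAt_const (1 : ℝ) (radialExt f z)).congr_of_eventuallyEq ?_)
  filter_upwards [lt_mem_nhds (zero_lt_one' ℝ)] with t ht
  exact radialExt_smul_arg f ht z

/-- A smooth radial cutoff, supported in an annulus. -/
def annulusBump : ContDiffBump (1 : ℝ) := ⟨1 / 4, 1 / 2, by norm_num, by norm_num⟩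

/-- The cutoff `annulusBump` as a function on `ℝ^p`. -/
def cutoff (z : 𝔼) : ℝ := annulusBump (‖z‖ ^ 2)

theorem contDiff_cutoff : ContDiff ℝ ∞ (cutoff (p := p)) :=
  annulusBump.contDiff.comp (contDiff_norm_sq ℝ)

theorem cutoff_eventually_zero : ∀ᶠ z in nhds (0 : 𝔼), cutoff z = 0 := by
  have h : ∀ᶠ z in nhds (0 : 𝔼), ‖z‖ ^ 2 < 1 / 2 :=
    ContinuousAt.eventually_lt (by fun_prop) (by fun_prop) (by norm_num)
  filter_upwards [h] with z hz
  refine annulusBump.zero_of_le_dist ?_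
  rw [Real.dist_eq, abs_of_neg (by linarith)]
  change 1 / 2 ≤ _
  linarith

theorem hasCompactSupport_cutoff : HasCompactSupport (cutoff (p := p)) := by
  refine HasCompactSupport.intro (isCompact_closedBall (0 : 𝔼) 2) fun z hz => ?_
  refine annulusBump.zero_of_le_dist ?_
  have : 2 < ‖z‖ := by simpa using hz
  rw [Real.dist_eq, abs_of_pos (by nlinarith)]
  change 1 / 2 ≤ _
  nlinarith

theorem fderiv_cutoff (z v : 𝔼) :
    fderiv ℝ cutoff z v = deriv annulusBump (‖z‖ ^ 2) * (2 * inner ℝ z v) := by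
  have h1 : HasDerivAt annulusBump (deriv annulusBump (‖z‖ ^ 2)) (‖z‖ ^ 2) :=
    (annulusBump.contDiff.differentiable (n := 1) (by simp)).differentiableAt.hasDerivAt
  have h2 := (hasStrictFDerivAt_norm_sq z).hasFDerivAt
  have h3 := h1.comp_hasFDerivAt z h2
  change fderiv ℝ (annulusBump ∘ fun z : 𝔼 => ‖z‖ ^ 2) z v = _
  rw [h3.fderiv]
  simp

/-- Integration in polar coordinates of a function homogeneous of degree `0` against a radial
function. -/
theorem integral_radial_mul_radialExt [NeZero p] (k : ℝ → ℝ) (u : Sph p → ℂ) :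
    ∫ z : 𝔼, (k ‖z‖ : ℂ) * radialExt u z =
      (∫ r : Set.Ioi (0 : ℝ), (k r : ℂ) ∂(Measure.volumeIoiPow (p - 1))) * ∫ x, u x ∂surf p := by
  have hfr : Module.finrank ℝ 𝔼 = p := by simp
  calc
    ∫ z : 𝔼, (k ‖z‖ : ℂ) * radialExt u z
      = ∫ z : ({(0)}ᶜ : Set 𝔼), (k ‖z.1‖ : ℂ) * radialExt u z.1
          ∂((volume : Measure 𝔼).comap (↑)) := by
      rw [integral_subtype_comap (measurableSet_singleton _).compl
        fun z : 𝔼 => (k ‖z‖ : ℂ) * radialExt u z, restrict_compl_singleton]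
    _ = ∫ w, u w.1 * (k w.2 : ℂ) ∂(surf p).prod (.volumeIoiPow (p - 1)) := by
      have := (volume : Measure 𝔼).measurePreserving_homeomorphUnitSphereProd.integral_comp
        (Homeomorph.measurableEmbedding _)
        (fun w : Sph p × Set.Ioi (0 : ℝ) => u w.1 * (k w.2 : ℂ))
      rw [hfr] at this
      rw [← this]
      refine integral_congr_ae (Filter.Eventually.of_forall fun z => ?_)
      have hz : (z : 𝔼) ≠ 0 := z.2
      simp only [radialExt, dif_pos hz]
      rw [mul_comm]
      congr 2
      · congr 1
        ext1
        simp
      · simp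
    _ = _ := by
      rw [integral_prod_mul u (fun r : Set.Ioi (0 : ℝ) => (k r : ℂ)), mul_comm]

/-- In polar coordinates the integral is a radial factor times the spherical integral. The radial
factor is nonzero: for `u = 1` the integrand is nonnegative, continuous, compactly supported and
positive at a unit vector. The weight `‖z‖⁻²` matches the homogeneity of the Laplacian of a radial
extension. -/
theorem integral_eq_zero_of_integral_radial [NeZero p] {u : Sph p → ℂ}
    (h : ∫ z : 𝔼, ((annulusBump (‖z‖ ^ 2) * (‖z‖ ^ 2)⁻¹ : ℝ) : ℂ) * radialExt u z = 0) :
    ∫ x, u x ∂surf p = 0 := by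
  have hp : ∃ i : Fin p, True := ⟨⟨0, Nat.pos_of_ne_zero (NeZero.ne p)⟩, trivial⟩
  obtain ⟨i, -⟩ := hp
  rw [integral_radial_mul_radialExt (fun r => annulusBump (r ^ 2) * (r ^ 2)⁻¹)] at h
  refine (mul_eq_zero.1 h).resolve_left fun h0 => ?_
  have h1 := integral_radial_mul_radialExt (p := p)
    (fun r => annulusBump (r ^ 2) * (r ^ 2)⁻¹) (fun _ => 1)
  rw [h0, zero_mul] at h1
  have h2 : ∫ z : 𝔼, cutoff z * (‖z‖ ^ 2)⁻¹ = 0 := by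
    rw [← Complex.ofReal_inj, ← integral_complex_ofReal, Complex.ofReal_zero, ← h1]
    refine integral_congr_ae ?_
    filter_upwards [Measure.ae_ne volume (0 : 𝔼)] with z hz
    simp [radialExt, hz, cutoff]
  refine (Continuous.integral_pos_of_hasCompactSupport_nonneg_nonzero
    (μ := (volume : Measure 𝔼)) (x := stdVec i) ?_ ?_ ?_ ?_).ne' h2
  · rw [continuous_iff_continuousAt]
    intro z
    by_cases hz : z = 0
    · subst hz
      refine (continuousAt_const (y := (0 : ℝ))).congr ?_
      filter_upwards [cutoff_eventually_zero (p := p)] with w hw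
      rw [hw, zero_mul]
    · have := contDiff_cutoff (p := p).continuous.continuousAt (x := z)
      exact this.mul (ContinuousAt.inv₀ (by fun_prop) (by simpa using hz))
  · exact hasCompactSupport_cutoff.mul_right
  · intro z
    exact mul_nonneg annulusBump.nonneg (by positivity)
  · have : cutoff (stdVec i : 𝔼) = 1 := by
      refine annulusBump.one_of_mem_closedBall ?_
      simp [annulusBump]
    rw [this]
    simp

/-- Integration by parts against the constant function `1`. -/
theorem integral_fderiv_eq_zero {W : 𝔼 → ℂ} (h : ContDiff ℝ 1 W) (hc : HasCompactSupport W)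
    (v : 𝔼) : ∫ z, fderiv ℝ W z v = 0 := by
  have h1 := integral_mul_fderiv_eq_neg_fderiv_mul_of_integrable (μ := (volume : Measure 𝔼))
    (f := fun _ => (1 : ℂ)) (g := W) (v := v) (by simp) ?_ ?_ (by simp)
    (fun x _ => (h.differentiable (by simp)).differentiableAt)
  · simpa using h1
  · simp only [one_mul]
    exact ((h.continuous_fderiv (by simp)).clm_apply continuous_const).integrable_of_hasCompactSupport
      (hc.fderiv_apply ℝ v)
  · simp only [one_mul]
    exact h.continuous.integrable_of_hasCompactSupport hc

/-- Green's formula on the round sphere. -/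
theorem integral_mul_sphLaplacian_comm [NeZero p] {f g : Sph p → ℂ} (hf : SmoothSph p f)
    (hg : SmoothSph p g) :
    ∫ x, (f x * sphLaplacian g x - g x * sphLaplacian f x) ∂surf p = 0 := by
  set F := radialExt f with hF
  set G := radialExt g with hG
  have hFs : ∀ {z : 𝔼}, z ≠ 0 → ContDiffAt ℝ ∞ F z := fun hz => contDiffAt_radialExt hf hz
  have hGs : ∀ {z : 𝔼}, z ≠ 0 → ContDiffAt ℝ ∞ G z := fun hz => contDiffAt_radialExt hg hz
  -- The components of the vector field `χ (F ∇G - G ∇F)`, with `χ` the cutoff. Since `χ` vanishes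
  -- near `0`, the field is smooth and compactly supported on all of `ℝ^p`, so its divergence
  -- integrates to zero.
  set W : Fin p → 𝔼 → ℂ := fun i z =>
    (cutoff z : ℂ) * (F z * fderiv ℝ G z (stdVec i) - G z * fderiv ℝ F z (stdVec i)) with hW
  have hdF : ∀ {F : 𝔼 → ℂ} {z : 𝔼}, ContDiffAt ℝ ∞ F z → ContDiffAt ℝ ∞ (fderiv ℝ F) z :=
    fun h => h.fderiv_right (by simp)
  have hχ : ContDiff ℝ ∞ fun z : 𝔼 => (cutoff z : ℂ) :=
    Complex.ofRealCLM.contDiff.comp contDiff_cutoff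
  have hWs : ∀ i, ContDiff ℝ ∞ (W i) := by
    intro i
    rw [contDiff_iff_contDiffAt]
    intro z
    by_cases hz : z = 0
    · subst hz
      refine (contDiffAt_const (c := (0 : ℂ))).congr_of_eventuallyEq ?_
      filter_upwards [cutoff_eventually_zero (p := p)] with w hw
      simp [hW, hw]
    · exact hχ.contDiffAt.mul (((hFs hz).mul ((hdF (hGs hz)).clm_apply contDiffAt_const)).sub
        ((hGs hz).mul ((hdF (hFs hz)).clm_apply contDiffAt_const)))
  have hWc : ∀ i, HasCompactSupport (W i) := by
    intro i
    refine HasCompactSupport.mul_right ?_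
    exact hasCompactSupport_cutoff.comp_left (g := fun r : ℝ => (r : ℂ)) Complex.ofReal_zero
  have hint : ∀ i, Integrable fun z => fderiv ℝ (W i) z (stdVec i) := fun i =>
    (((hWs i).continuous_fderiv (by simp)).clm_apply
      continuous_const).integrable_of_hasCompactSupport ((hWc i).fderiv_apply ℝ _)
  have hsum : ∫ z : 𝔼, ∑ i, fderiv ℝ (W i) z (stdVec i) = 0 := by
    rw [integral_finsetSum _ fun i _ => hint i]
    exact Finset.sum_eq_zero fun i _ =>
      integral_fderiv_eq_zero ((hWs i).of_le (by simp)) (hWc i) _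
  have hdiv : ∀ z : 𝔼, z ≠ 0 → ∑ i, fderiv ℝ (W i) z (stdVec i)
      = (cutoff z : ℂ) * (F z * Laplacian.laplacian G z - G z * Laplacian.laplacian F z) := by
    intro z hz
    have hFd := ((hFs hz).differentiableAt (by simp)).hasFDerivAt
    have hGd := ((hGs hz).differentiableAt (by simp)).hasFDerivAt
    have hFd' := ((hdF (hFs hz)).differentiableAt (by simp)).hasFDerivAt
    have hGd' := ((hdF (hGs hz)).differentiableAt (by simp)).hasFDerivAt
    have hχd : HasFDerivAt (fun z : 𝔼 => (cutoff z : ℂ))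
        (Complex.ofRealCLM.comp (fderiv ℝ cutoff z)) z :=
      Complex.ofRealCLM.hasFDerivAt.comp z
        ((contDiff_cutoff.differentiable (by simp)).differentiableAt.hasFDerivAt)
    have hWd : ∀ i, fderiv ℝ (W i) z (stdVec i) =
        (fderiv ℝ cutoff z (stdVec i) : ℂ)
          * (F z * fderiv ℝ G z (stdVec i) - G z * fderiv ℝ F z (stdVec i))
        + (cutoff z : ℂ) * (F z * fderiv ℝ (fderiv ℝ G) z (stdVec i) (stdVec i)
          - G z * fderiv ℝ (fderiv ℝ F) z (stdVec i) (stdVec i)) := by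
      intro i
      have hv : HasFDerivAt (fun _ : 𝔼 => stdVec i) (0 : 𝔼 →L[ℝ] 𝔼) z := hasFDerivAt_const _ z
      have := hχd.mul ((hFd.mul (hGd'.clm_apply hv)).sub (hGd.mul (hFd'.clm_apply hv)))
      have h2 : fderiv ℝ (W i) z = _ := this.fderiv
      rw [h2]
      simp
      ring
    simp only [hWd]
    rw [Finset.sum_add_distrib, ← Finset.mul_sum, Finset.sum_sub_distrib, ← Finset.mul_sum,
      ← Finset.mul_sum, ← laplacian_eq_sum_fderiv, ← laplacian_eq_sum_fderiv, add_eq_right]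
    -- `∇χ` is parallel to `z`, so it pairs to zero with the gradient of a function having no radial
    -- derivative. Only `χ (F ΔG - G ΔF)` survives in the divergence.
    have hrad : ∀ H : 𝔼 → ℂ, fderiv ℝ H z z = 0 →
        ∑ i, (fderiv ℝ cutoff z (stdVec i) : ℂ) * fderiv ℝ H z (stdVec i) = 0 := by
      intro H hH
      have : ∑ i, (z i : ℂ) * fderiv ℝ H z (stdVec i) = 0 := by
        rw [← hH]
        conv_rhs => rw [← sum_coord_smul_stdVec z]
        rw [sum_coord_smul_stdVec, ← sum_coord_smul_stdVec z, map_sum]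
        simp only [sum_coord_smul_stdVec, map_smul, Complex.real_smul]
      simp only [fderiv_cutoff]
      have hz : ∀ i, inner ℝ z (stdVec i) = z i := fun i => by
        simp [stdVec, EuclideanSpace.inner_single_right]
      simp only [hz]
      push_cast
      simp only [mul_assoc, ← Finset.mul_sum, this, mul_zero]
    have hG0 := hrad G (fderiv_radialExt_self hg hz)
    have hF0 := hrad F (fderiv_radialExt_self hf hz)
    calc
      _ = F z * ∑ i, (fderiv ℝ cutoff z (stdVec i) : ℂ) * fderiv ℝ G z (stdVec i)
          - G z * ∑ i, (fderiv ℝ cutoff z (stdVec i) : ℂ) * fderiv ℝ F z (stdVec i) := by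
        rw [Finset.mul_sum, Finset.mul_sum, ← Finset.sum_sub_distrib]
        exact Finset.sum_congr rfl fun i _ => by ring
      _ = 0 := by rw [hG0, hF0, mul_zero, mul_zero, sub_zero]
  refine integral_eq_zero_of_integral_radial ?_
  rw [← hsum]
  refine integral_congr_ae ?_
  filter_upwards [Measure.ae_ne volume (0 : 𝔼)] with z hz
  rw [hdiv z hz]
  obtain ⟨r, hr, x, rfl⟩ : ∃ r : ℝ, 0 < r ∧ ∃ x : Sph p, z = r • (x : 𝔼) :=
    ⟨‖z‖, norm_pos_iff.2 hz, ⟨‖z‖⁻¹ • z, by simp [norm_smul, hz]⟩, by simp [smul_smul, hz]⟩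
  rw [radialExt_smul_coe _ hr, hF, hG, radialExt_smul_coe _ hr, radialExt_smul_coe _ hr,
    laplacian_radialExt_smul _ hr, laplacian_radialExt_smul _ hr, cutoff]
  have : ‖r • (x : 𝔼)‖ = r := by simp [norm_smul, hr.le]
  rw [this]
  push_cast
  ring

end Green

/-! ## Spherical harmonics from homogeneous polynomials -/

section Harmonics

variable {p : ℕ}

local notation "𝔼" => EuclideanSpace ℝ (Fin p)

theorem laplacian_eq_sum_fderiv_fderiv {F : 𝔼 → ℂ} {z : 𝔼}
    (hF : DifferentiableAt ℝ (fderiv ℝ F) z) :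
    Laplacian.laplacian F z
      = ∑ i, fderiv ℝ (fun w => fderiv ℝ F w (stdVec i)) z (stdVec i) := by
  rw [laplacian_eq_sum_fderiv]
  refine Finset.sum_congr rfl fun i _ => ?_
  rw [fderiv_clm_apply hF (differentiableAt_const _)]
  simp

/-- The polynomial function on `ℝ^p` defined by a complex polynomial. -/
def polyFun (P : MvPolynomial (Fin p) ℂ) (z : 𝔼) : ℂ :=
  MvPolynomial.eval (fun i => (z i : ℂ)) P

theorem contDiff_coord (i : Fin p) : ContDiff ℝ ∞ fun z : 𝔼 => (z i : ℂ) :=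
  (Complex.ofRealCLM.comp (EuclideanSpace.proj (𝕜 := ℝ) i)).contDiff

theorem fderiv_coord (i j : Fin p) (z : 𝔼) :
    fderiv ℝ (fun z : 𝔼 => (z i : ℂ)) z (stdVec j) = if i = j then 1 else 0 := by
  have : fderiv ℝ (fun z : 𝔼 => (z i : ℂ)) z
      = Complex.ofRealCLM.comp (EuclideanSpace.proj (𝕜 := ℝ) i) :=
    (Complex.ofRealCLM.comp (EuclideanSpace.proj (𝕜 := ℝ) i)).fderiv
  rw [this]
  by_cases h : i = j <;> simp [h, stdVec]

theorem polyFun_C (a : ℂ) : polyFun (p := p) (MvPolynomial.C a) = fun _ => a := by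
  funext z
  simp [polyFun]

theorem polyFun_add (P Q : MvPolynomial (Fin p) ℂ) :
    polyFun (P + Q) = fun z => polyFun P z + polyFun Q z := by
  funext z
  simp [polyFun]

theorem polyFun_mul_X (P : MvPolynomial (Fin p) ℂ) (i : Fin p) :
    polyFun (P * MvPolynomial.X i) = fun z => polyFun P z * (z i : ℂ) := by
  funext z
  simp [polyFun]

theorem contDiff_polyFun (P : MvPolynomial (Fin p) ℂ) : ContDiff ℝ ∞ (polyFun P) := by
  induction P using MvPolynomial.induction_on with
  | C a => rw [polyFun_C]; exact contDiff_const
  | add P Q hP hQ => rw [polyFun_add]; exact hP.add hQ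
  | mul_X P i hP => rw [polyFun_mul_X]; exact hP.mul (contDiff_coord i)

theorem differentiableAt_polyFun (P : MvPolynomial (Fin p) ℂ) (z : 𝔼) :
    DifferentiableAt ℝ (polyFun P) z :=
  ((contDiff_polyFun P).differentiable (by simp)).differentiableAt

theorem fderiv_polyFun (P : MvPolynomial (Fin p) ℂ) (i : Fin p) (z : 𝔼) :
    fderiv ℝ (polyFun P) z (stdVec i) = polyFun (MvPolynomial.pderiv i P) z := by
  induction P using MvPolynomial.induction_on with
  | C a =>
    rw [polyFun_C]
    simp [polyFun]
  | add P Q hP hQ =>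
    rw [polyFun_add, fderiv_fun_add (differentiableAt_polyFun P z) (differentiableAt_polyFun Q z),
      add_apply, hP, hQ]
    simp [polyFun]
  | mul_X P j hP =>
    rw [polyFun_mul_X, fderiv_fun_mul (differentiableAt_polyFun P z)
      ((contDiff_coord j).differentiable (by simp)).differentiableAt]
    simp only [add_apply, smul_apply, hP, fderiv_coord, Derivation.leibniz,
      MvPolynomial.pderiv_X, Pi.single_apply, smul_eq_mul]
    by_cases h : j = i
    · subst h
      simp [polyFun]
    · simp [polyFun, h]

theorem polyFun_smul {P : MvPolynomial (Fin p) ℂ} {k : ℕ} (hP : P.IsHomogeneous k) (c : ℝ)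
    (z : 𝔼) : polyFun P (c • z) = (c : ℂ) ^ k * polyFun P z := by
  rw [polyFun, polyFun, MvPolynomial.eval_eq, MvPolynomial.eval_eq, Finset.mul_sum]
  refine Finset.sum_congr rfl fun d hd => ?_
  have hk : ∑ i, d i = k := by
    have := hP (MvPolynomial.mem_support_iff.1 hd)
    rw [Finsupp.weight_apply, Finsupp.sum_fintype _ _ (by simp)] at this
    simpa using this
  have : ∏ i ∈ d.support, (((c • z) i : ℝ) : ℂ) ^ d i
      = (c : ℂ) ^ k * ∏ i ∈ d.support, (z i : ℂ) ^ d i := by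
    rw [← hk, ← Finset.prod_pow_eq_pow_sum,
      ← Finset.prod_subset (Finset.subset_univ d.support) (f := fun i => (c : ℂ) ^ d i)
        (fun i _ hi => by simp [Finsupp.notMem_support_iff.1 hi]), ← Finset.prod_mul_distrib]
    refine Finset.prod_congr rfl fun i _ => ?_
    simp [mul_pow]
  rw [this]
  ring

/-- The power `‖z‖^(2s)`. -/
def normSqPow (s : ℝ) (z : 𝔼) : ℂ := (((‖z‖ ^ 2) ^ s : ℝ) : ℂ)

theorem hasFDerivAt_normSqPow (s : ℝ) {z : 𝔼} (hz : z ≠ 0) :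
    HasFDerivAt (normSqPow (p := p) s) (Complex.ofRealCLM.comp
      ((s * (‖z‖ ^ 2) ^ (s - 1)) • (2 • innerSL ℝ z))) z :=
  Complex.ofRealCLM.hasFDerivAt.comp z ((hasStrictFDerivAt_norm_sq z).hasFDerivAt.rpow_const
    (Or.inl (by simpa using hz)))

theorem fderiv_normSqPow (s : ℝ) {z : 𝔼} (hz : z ≠ 0) (i : Fin p) :
    fderiv ℝ (normSqPow s) z (stdVec i) = 2 * s * z i * normSqPow (s - 1) z := by
  rw [(hasFDerivAt_normSqPow s hz).fderiv]
  simp [stdVec, EuclideanSpace.inner_single_right, normSqPow]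
  ring

/-- The restriction to the sphere of a polynomial function. -/
def polySph (P : MvPolynomial (Fin p) ℂ) : C(Sph p, ℂ) :=
  ⟨fun x => polyFun P x, (contDiff_polyFun P).continuous.comp continuous_subtype_val⟩

theorem smoothSph_polySph [NeZero p] (P : MvPolynomial (Fin p) ℂ) :
    SmoothSph p (polySph P) :=
  (contDiff_polyFun P).contMDiff.comp (contMDiff_coe_sphere (n := p - 1))

theorem radialExt_polySph {P : MvPolynomial (Fin p) ℂ} {k : ℕ} (hP : P.IsHomogeneous k) {z : 𝔼}
    (hz : z ≠ 0) : radialExt (polySph P) z = normSqPow (-k / 2) z * polyFun P z := by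
  rw [radialExt, dif_pos hz]
  change polyFun P (‖z‖⁻¹ • z) = _
  rw [polyFun_smul hP, normSqPow, ← Real.rpow_natCast ‖z‖ 2, ← Real.rpow_mul (norm_nonneg _)]
  congr 1
  have : ((2 : ℕ) : ℝ) * (-k / 2) = -(k : ℝ) := by push_cast; ring
  rw [this, Real.rpow_neg (norm_nonneg _), Real.rpow_natCast]
  push_cast
  rw [inv_pow]

/-- The Laplacian of a polynomial. -/
def polyLap (P : MvPolynomial (Fin p) ℂ) : MvPolynomial (Fin p) ℂ :=
  ∑ i, MvPolynomial.pderiv i (MvPolynomial.pderiv i P)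

/-- Near the sphere the radial extension is `‖z‖^(-k) P(z)`. Apply the product rule, Euler's
identity `∑ xᵢ ∂ᵢP = k P` and `‖x‖ = 1`; with `s = -k/2` the scalar `4sk + 2sp + 4s(s-1)` equals
`-k(k+p-2)`. -/
theorem sphLaplacian_polySph [NeZero p] {P : MvPolynomial (Fin p) ℂ} {k : ℕ}
    (hP : P.IsHomogeneous k) (x : Sph p) :
    sphLaplacian (polySph P) x
      = polySph (polyLap P) x - (k : ℂ) * ((k : ℂ) + (p : ℂ) - 2) * polySph P x := by
  have hx := sph_ne_zero x
  set s : ℝ := -k / 2 with hs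
  set F := radialExt (polySph P) with hF
  have hFd : ∀ i, ∀ z : 𝔼, z ≠ 0 → fderiv ℝ F z (stdVec i)
      = normSqPow s z * polyFun (MvPolynomial.pderiv i P) z
        + polyFun P z * (2 * s * z i * normSqPow (s - 1) z) := by
    intro i z hz
    have : F =ᶠ[nhds z] fun z => normSqPow s z * polyFun P z := by
      filter_upwards [isOpen_compl_singleton.mem_nhds hz] with w hw
      exact radialExt_polySph hP hw
    rw [this.fderiv_eq, fderiv_fun_mul (hasFDerivAt_normSqPow s hz).differentiableAt
      (differentiableAt_polyFun P z), add_apply, smul_apply, smul_apply, fderiv_polyFun,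
      fderiv_normSqPow s hz, smul_eq_mul, smul_eq_mul]
  have hn1 : ∀ s : ℝ, normSqPow s (x : 𝔼) = 1 := fun s => by simp [normSqPow]
  have hFdd : ∀ i, fderiv ℝ (fun w => fderiv ℝ F w (stdVec i)) (x : 𝔼) (stdVec i)
      = polyFun (MvPolynomial.pderiv i (MvPolynomial.pderiv i P)) x
        + 4 * s * ((x : 𝔼) i * polyFun (MvPolynomial.pderiv i P) x)
        + 2 * s * polyFun P x + 4 * s * (s - 1) * polyFun P x * ((x : 𝔼) i) ^ 2 := by
    intro i
    have : (fun w => fderiv ℝ F w (stdVec i)) =ᶠ[nhds (x : 𝔼)] fun z =>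
        normSqPow s z * polyFun (MvPolynomial.pderiv i P) z
        + polyFun P z * (2 * s * z i * normSqPow (s - 1) z) := by
      filter_upwards [isOpen_compl_singleton.mem_nhds hx] with w hw
      exact hFd i w hw
    have hd1 := (hasFDerivAt_normSqPow s hx).differentiableAt
    have hd2 := (hasFDerivAt_normSqPow (s - 1) hx).differentiableAt
    have hd3 := differentiableAt_polyFun P (x : 𝔼)
    have hd4 := differentiableAt_polyFun (MvPolynomial.pderiv i P) (x : 𝔼)
    have hd5 : DifferentiableAt ℝ (fun z : 𝔼 => (z i : ℂ)) x :=
      ((contDiff_coord i).differentiable (by simp)).differentiableAt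
    have hd6 : DifferentiableAt ℝ (fun z : 𝔼 => 2 * (s : ℂ) * (z i : ℂ)) x := hd5.const_mul _
    rw [this.fderiv_eq, fderiv_fun_add (hd1.fun_mul hd4) (hd3.fun_mul (hd6.fun_mul hd2)),
      fderiv_fun_mul hd1 hd4, fderiv_fun_mul hd3 (hd6.fun_mul hd2), fderiv_fun_mul hd6 hd2,
      fderiv_const_mul hd5]
    simp only [add_apply, smul_apply, smul_eq_mul, fderiv_polyFun, fderiv_normSqPow _ hx,
      fderiv_coord, hn1, if_true]
    push_cast
    ring
  rw [sphLaplacian, laplacian_eq_sum_fderiv_fderiv]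
  · simp only [← hF, hFdd, Finset.sum_add_distrib, ← Finset.mul_sum]
    have h1 : ∑ i, ((x : 𝔼) i : ℂ) * polyFun (MvPolynomial.pderiv i P) x = k * polyFun P x := by
      have := congrArg (fun Q => polyFun Q (x : 𝔼)) hP.sum_X_mul_pderiv
      simpa [polyFun] using this
    have h2 : ∑ i, (((x : 𝔼) i : ℂ)) ^ 2 = 1 := by
      have : ∑ i, ((x : 𝔼) i) ^ 2 = 1 := by
        have := EuclideanSpace.norm_sq_eq (x : 𝔼)
        simpa using this.symm
      exact_mod_cast this
    have h3 : ∑ i, polyFun (MvPolynomial.pderiv i (MvPolynomial.pderiv i P)) (x : 𝔼)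
        = polySph (polyLap P) x := by
      simp [polySph, polyFun, polyLap]
    have h4 : polySph P x = polyFun P x := rfl
    rw [h1, h2, h3, h4]
    simp only [Finset.sum_const, Finset.card_univ, Fintype.card_fin, nsmul_eq_mul, hs]
    push_cast
    ring
  · have : ContDiffAt ℝ ∞ (fderiv ℝ F) (x : 𝔼) :=
      (contDiffAt_radialExt (smoothSph_polySph P) hx).fderiv_right (by simp)
    exact this.differentiableAt (by simp)

theorem isHomogeneous_polyLap {P : MvPolynomial (Fin p) ℂ} {k : ℕ} (hP : P.IsHomogeneous k) :
    (polyLap P).IsHomogeneous (k - 1 - 1) :=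
  MvPolynomial.IsHomogeneous.sum _ _ _ fun _ _ => hP.pderiv.pderiv

theorem polyLap_eq_zero {P : MvPolynomial (Fin p) ℂ} {k : ℕ} (hP : P.IsHomogeneous k)
    (hk : k ≤ 1) : polyLap P = 0 := by
  have h0 : ∀ {Q : MvPolynomial (Fin p) ℂ}, Q.IsHomogeneous 0 → ∀ i,
      MvPolynomial.pderiv i Q = 0 := by
    intro Q hQ i
    have := MvPolynomial.totalDegree_eq_zero_iff_eq_C.1 (Nat.le_zero.1 hQ.totalDegree_le)
    rw [this, MvPolynomial.pderiv_C]
  refine Finset.sum_eq_zero fun i _ => h0 ?_ i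
  have := hP.pderiv (i := i)
  rwa [Nat.sub_eq_zero_of_le hk] at this

/-- Smooth functions on the sphere, as a subspace of the continuous functions. -/
def smoothSubmodule (p : ℕ) [NeZero p] : Submodule ℂ C(Sph p, ℂ) where
  carrier := {f | SmoothSph p f}
  zero_mem' := contMDiff_const
  add_mem' hf hg := ContMDiff.add hf hg
  smul_mem' c _ hf := (contDiff_const_smul (𝕜 := ℝ) (F := ℂ) c).comp_contMDiff hf

/-- The Laplace-Beltrami operator as a linear map. -/
def sphLaplacianLinear (p : ℕ) [NeZero p] : smoothSubmodule p →ₗ[ℂ] (Sph p → ℂ) where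
  toFun f := sphLaplacian f.1
  map_add' f g := funext fun x => sphLaplacian_add f.2 g.2 x
  map_smul' c f := funext fun x => sphLaplacian_smul c f.2 x

/-- The degree `k` spherical harmonics as a subspace. -/
def harmonicsSubmodule (p k : ℕ) [NeZero p] : Submodule ℂ C(Sph p, ℂ) where
  carrier := harmonics p k
  zero_mem' := by
    refine ⟨(smoothSubmodule p).zero_mem, fun x => ?_⟩
    exact (congrFun (map_zero (sphLaplacianLinear p)) x).trans (by simp)
  add_mem' := by
    rintro f g ⟨hf, hf'⟩ ⟨hg, hg'⟩
    refine ⟨(smoothSubmodule p).add_mem hf hg, fun x => ?_⟩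
    rw [ContinuousMap.coe_add, sphLaplacian_add hf hg, hf', hg', Pi.add_apply, mul_add]
  smul_mem' := by
    rintro c f ⟨hf, hf'⟩
    refine ⟨(smoothSubmodule p).smul_mem c hf, fun x => ?_⟩
    rw [ContinuousMap.coe_smul, sphLaplacian_smul c hf, hf', Pi.smul_apply, smul_eq_mul]
    ring

/-- The eigenvalue of `-Δ` on spherical harmonics of degree `k`. -/
def lapEigval (p k : ℕ) : ℝ := k * (k + p - 2)

theorem lapEigval_strictMono (hp : 2 ≤ p) : StrictMono (lapEigval p) := by
  intro j k hjk
  have h1 : (j : ℝ) < k := Nat.cast_lt.2 hjk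
  have h2 : (2 : ℝ) ≤ p := by exact_mod_cast hp
  have h3 : (0 : ℝ) ≤ j := Nat.cast_nonneg j
  unfold lapEigval
  nlinarith

theorem mem_harmonicsSubmodule [NeZero p] {k : ℕ} {f : C(Sph p, ℂ)} (hf : f ∈ smoothSubmodule p) :
    f ∈ harmonicsSubmodule p k ↔
      sphLaplacianLinear p ⟨f, hf⟩ = -(lapEigval p k : ℂ) • (f : Sph p → ℂ) := by
  refine ⟨fun h => funext fun x => ?_, fun h => ⟨hf, fun x => ?_⟩⟩
  · refine (h.2 x).trans ?_
    simp [lapEigval]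
  · refine (congrFun h x).trans ?_
    simp [lapEigval]

/-- With `Λ_j` for `lapEigval p j`, the function `(Δ_S + Λ_k) P` is the restriction of the Euclidean
Laplacian of `P`, which by induction is a sum of harmonics `w_j` with `j < k`. Setting `u_j = w_j /
(Λ_k - Λ_j)` solves the same equation, so `P - ∑ u_j` is killed by `Δ_S + Λ_k`, hence harmonic of
degree `k`. -/
theorem exists_sum_harmonics [Fact (2 ≤ p)] (k : ℕ) : ∀ {P : MvPolynomial (Fin p) ℂ},
    P.IsHomogeneous k → ∃ w : ℕ → C(Sph p, ℂ), (∀ j, w j ∈ harmonicsSubmodule p j) ∧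
      polySph P = ∑ j ∈ Finset.range (k + 1), w j := by
  induction k using Nat.strong_induction_on with
  | _ k ih =>
  intro P hP
  obtain ⟨w, hw, hs⟩ : ∃ w : ℕ → C(Sph p, ℂ), (∀ j, w j ∈ harmonicsSubmodule p j) ∧
      polySph (polyLap P) = ∑ j ∈ Finset.range k, w j := by
    rcases Nat.lt_or_ge k 2 with h | h
    · refine ⟨fun _ => 0, fun j => Submodule.zero_mem _, ?_⟩
      rw [polyLap_eq_zero hP (by omega)]
      ext x
      simp [polySph, polyFun]
    · obtain ⟨w, hw, hs⟩ := ih (k - 1 - 1) (by omega) (isHomogeneous_polyLap hP)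
      -- The induction hypothesis in degree `k - 2` gives a sum over `j < k - 1`; pad it with a zero
      -- term.
      refine ⟨fun j => if j < k - 1 then w j else 0, fun j => ?_, ?_⟩
      · dsimp only
        split_ifs
        exacts [hw j, Submodule.zero_mem _]
      · rw [hs, ← Finset.sum_filter]
        refine Finset.sum_congr ?_ fun _ _ => rfl
        ext j
        simp only [Finset.mem_range, Finset.mem_filter]
        omega
  have hne : ∀ j ∈ Finset.range k, ((lapEigval p k : ℂ) - lapEigval p j) ≠ 0 := by
    intro j hj
    rw [← Complex.ofReal_sub, Complex.ofReal_ne_zero]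
    exact (sub_pos.2 (lapEigval_strictMono Fact.out (Finset.mem_range.1 hj))).ne'
  set u : ℕ → C(Sph p, ℂ) := fun j => ((lapEigval p k : ℂ) - lapEigval p j)⁻¹ • w j with hu
  have hum : ∀ j, u j ∈ harmonicsSubmodule p j := fun j => Submodule.smul_mem _ _ (hw j)
  have hus : ∀ j, u j ∈ smoothSubmodule p := fun j => (hum j).1
  have hPs : polySph P ∈ smoothSubmodule p := smoothSph_polySph P
  set v := polySph P - ∑ j ∈ Finset.range k, u j with hv
  have hvm : v ∈ harmonicsSubmodule p k := by
    have hvs : v ∈ smoothSubmodule p :=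
      Submodule.sub_mem _ hPs (Submodule.sum_mem _ fun j _ => hus j)
    rw [mem_harmonicsSubmodule hvs]
    have hadd : (⟨polySph P, hPs⟩ : smoothSubmodule p)
        = ⟨v, hvs⟩ + ∑ j ∈ Finset.range k, ⟨u j, hus j⟩ := by
      ext1
      simp [hv]
    funext x
    have h0 := congrFun (congrArg (sphLaplacianLinear p) hadd) x
    rw [map_add, map_sum, Pi.add_apply, Finset.sum_apply] at h0
    have h1 : sphLaplacianLinear p ⟨polySph P, hPs⟩ x
        = ∑ j ∈ Finset.range k, w j x - lapEigval p k * polySph P x := by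
      refine (sphLaplacian_polySph hP x).trans ?_
      rw [hs]
      simp [lapEigval]
    have h2 : ∀ j, sphLaplacianLinear p ⟨u j, hus j⟩ x = -(lapEigval p j : ℂ) * u j x := fun j =>
      congrFun ((mem_harmonicsSubmodule (hus j)).1 (hum j)) x
    have h3 : ∑ j ∈ Finset.range k, w j x
        = ∑ j ∈ Finset.range k, ((lapEigval p k : ℂ) - lapEigval p j) * u j x := by
      refine Finset.sum_congr rfl fun j hj => ?_
      simp only [hu, ContinuousMap.smul_apply, smul_eq_mul]
      rw [mul_inv_cancel_left₀ (hne j hj)]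
    rw [← sub_eq_iff_eq_add] at h0
    rw [← h0, h1]
    simp only [h2, h3, hv, Pi.smul_apply,
      ContinuousMap.sub_apply, ContinuousMap.sum_apply, smul_eq_mul, mul_sub, Finset.mul_sum,
      sub_mul, Finset.sum_sub_distrib, neg_mul, Finset.sum_neg_distrib]
    ring
  refine ⟨fun j => if j = k then v else u j, fun j => ?_, ?_⟩
  · dsimp only
    split_ifs with h
    · rw [h]
      exact hvm
    · exact hum j
  · rw [Finset.sum_range_succ, if_pos rfl, Finset.sum_congr rfl fun j hj => if_neg ?_, hv]
    · abel
    · exact (Finset.mem_range.1 hj).ne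

end Harmonics

/-! ## Density of products of spherical harmonics -/

section Density

/-- The function `(x, y) ↦ Y x * Z y` on `M`, bilinear in `Y` and `Z`. -/
def tensorHom (p q : ℕ) : C(Sph p, ℂ) →ₗ[ℂ] C(Sph q, ℂ) →ₗ[ℂ] C(M p q, ℂ) :=
  LinearMap.mk₂ ℂ (fun Y Z => Y.comp ContinuousMap.fst * Z.comp ContinuousMap.snd)
    (fun _ _ _ => by ext; simp [add_mul]) (fun _ _ _ => by ext; simp [mul_assoc])
    (fun _ _ _ => by ext; simp [mul_add]) (fun _ _ _ => by ext; simp [mul_left_comm])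

@[simp]
theorem tensorHom_apply {p q : ℕ} (Y : C(Sph p, ℂ)) (Z : C(Sph q, ℂ)) (z : M p q) :
    tensorHom p q Y Z z = Y z.1 * Z z.2 := rfl

/-- The span of the products of spherical harmonics. -/
def harmonicTensors (p q : ℕ) [NeZero p] [NeZero q] : Submodule ℂ C(M p q, ℂ) :=
  Submodule.map₂ (tensorHom p q) (⨆ a, harmonicsSubmodule p a) (⨆ b, harmonicsSubmodule q b)

theorem polySph_mem_iSup {p : ℕ} [Fact (2 ≤ p)] {k : ℕ} {P : MvPolynomial (Fin p) ℂ}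
    (hP : P.IsHomogeneous k) : polySph P ∈ ⨆ a, harmonicsSubmodule p a := by
  obtain ⟨w, hw, hs⟩ := exists_sum_harmonics k hP
  rw [hs]
  exact Submodule.sum_mem _ fun j _ => Submodule.mem_iSup_of_mem j (hw j)

/-- The coordinate functions on `M`. -/
def coordM (p q : ℕ) : Fin p ⊕ Fin q → C(M p q, ℂ)
  | Sum.inl i => ⟨fun z => ((z.1 : EuclideanSpace ℝ (Fin p)) i : ℂ), by fun_prop⟩
  | Sum.inr i => ⟨fun z => ((z.2 : EuclideanSpace ℝ (Fin q)) i : ℂ), by fun_prop⟩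

/-- A monomial in `(x, y)` is a monomial in `x` times a monomial in `y`, and each factor is
homogeneous, so `exists_sum_harmonics` applies to both. -/
theorem aeval_coordM_mem {p q : ℕ} [Fact (2 ≤ p)] [Fact (2 ≤ q)]
    (P : MvPolynomial (Fin p ⊕ Fin q) ℂ) :
    MvPolynomial.aeval (coordM p q) P ∈ harmonicTensors p q := by
  induction P using MvPolynomial.induction_on' with
  | add P Q hP hQ =>
    rw [map_add]
    exact Submodule.add_mem _ hP hQ
  | monomial s c =>
    have h : MvPolynomial.aeval (coordM p q) (MvPolynomial.monomial s c)
        = c • tensorHom p q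
          (polySph (MvPolynomial.monomial
            (Finsupp.equivFunOnFinite.symm fun i => s (Sum.inl i)) 1))
          (polySph (MvPolynomial.monomial
            (Finsupp.equivFunOnFinite.symm fun i => s (Sum.inr i)) 1)) := by
      ext z
      rw [MvPolynomial.aeval_monomial, Finsupp.prod_fintype _ _ (by simp)]
      simp [polySph, polyFun, MvPolynomial.eval_monomial, Finsupp.prod_fintype,
        Fintype.prod_sum_type, coordM]
    rw [h]
    exact Submodule.smul_mem _ _ (Submodule.apply_mem_map₂ _
      (polySph_mem_iSup (MvPolynomial.isHomogeneous_monomial _ rfl))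
      (polySph_mem_iSup (MvPolynomial.isHomogeneous_monomial _ rfl)))

/-- Stone–Weierstrass for the polynomials in the coordinates: they separate points, and are stable
under conjugation because the coordinates are real. -/
theorem dense_harmonicTensors (p q : ℕ) [Fact (2 ≤ p)] [Fact (2 ≤ q)] :
    (harmonicTensors p q).topologicalClosure = ⊤ := by
  set A : StarSubalgebra ℂ C(M p q, ℂ) :=
    { (MvPolynomial.aeval (R := ℂ) (coordM p q)).range with
      star_mem' := by
        rintro _ ⟨P, rfl⟩
        change star _ ∈ (MvPolynomial.aeval (R := ℂ) (coordM p q)).range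
        induction P using MvPolynomial.induction_on with
        | C a => exact ⟨MvPolynomial.C (star a), by ext; simp⟩
        | add P Q hP hQ =>
          rw [map_add, star_add]
          exact Subalgebra.add_mem _ hP hQ
        | mul_X P i hP =>
          rw [map_mul, star_mul']
          refine Subalgebra.mul_mem _ hP ⟨MvPolynomial.X i, ?_⟩
          ext z
          cases i <;> simp [coordM] } with hA
  have hsep : A.SeparatesPoints := by
    intro z w hzw
    have : ∃ i, coordM p q i z ≠ coordM p q i w := by
      by_contra! h
      refine hzw (Prod.ext (Subtype.ext ?_) (Subtype.ext ?_))
      · ext i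
        exact Complex.ofReal_inj.1 (h (Sum.inl i))
      · ext i
        exact Complex.ofReal_inj.1 (h (Sum.inr i))
    obtain ⟨i, hi⟩ := this
    exact ⟨_, ⟨coordM p q i, ⟨MvPolynomial.X i, by simp⟩, rfl⟩, hi⟩
  have h1 := ContinuousMap.starSubalgebra_topologicalClosure_eq_top_of_separatesPoints A hsep
  rw [eq_top_iff]
  intro f _
  have h2 : f ∈ A.topologicalClosure := h1 ▸ trivial
  refine closure_mono ?_ h2
  rintro _ ⟨P, rfl⟩
  exact aeval_coordM_mem P

theorem toL2_coeFn {p q : ℕ} (f : C(M p q, ℂ)) : toL2 p q f =ᵐ[vol p q] f :=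
  ContinuousMap.coeFn_toLp (vol p q) f

theorem toL2_tensorHom_mem_kType {p q : ℕ} [NeZero p] [NeZero q] {a b : ℕ} {Y : C(Sph p, ℂ)}
    {Z : C(Sph q, ℂ)} (hY : Y ∈ harmonics p a) (hZ : Z ∈ harmonics q b) :
    toL2 p q (tensorHom p q Y Z) ∈ kType p q a b :=
  Submodule.le_topologicalClosure _ (Submodule.subset_span ⟨Y, hY, Z, hZ, toL2_coeFn _⟩)

theorem iSup_kType_topologicalClosure (p q : ℕ) [Fact (2 ≤ p)] [Fact (2 ≤ q)] :
    (⨆ k : ℕ × ℕ, kType p q k.1 k.2).topologicalClosure = ⊤ := by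
  have h1 := (ContinuousMap.toLp_denseRange ℂ (vol p q) ℂ
    (p := 2) (by simp)).topologicalClosure_map_submodule (dense_harmonicTensors p q)
  rw [eq_top_iff, ← h1]
  refine Submodule.topologicalClosure_mono ?_
  rw [Submodule.map_le_iff_le_comap, harmonicTensors, Submodule.map₂_le]
  intro Y hY Z hZ
  induction hY using Submodule.iSup_induction' with
  | zero => rw [map_zero, LinearMap.zero_apply]; exact Submodule.zero_mem _
  | add Y Y' _ _ h h' => rw [map_add, LinearMap.add_apply]; exact Submodule.add_mem _ h h'
  | mem a Y hY =>
    induction hZ using Submodule.iSup_induction' with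
    | zero => rw [map_zero]; exact Submodule.zero_mem _
    | add Z Z' _ _ h h' => rw [map_add]; exact Submodule.add_mem _ h h'
    | mem b Z hZ => exact Submodule.mem_iSup_of_mem (a, b) (toL2_tensorHom_mem_kType hY hZ)

end Density

/-! ## Orthogonality -/

section Orthogonality

theorem sphLaplacian_star {p : ℕ} [NeZero p] {f : Sph p → ℂ} (hf : SmoothSph p f) (x : Sph p) :
    sphLaplacian (star f) x = star (sphLaplacian f x) := by
  have h1 : radialExt (star f) = Complex.conjCLE.toContinuousLinearMap ∘ radialExt f := by
    funext z
    by_cases h : z = 0 <;> simp [radialExt, h]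
  rw [sphLaplacian, h1, ((contDiffAt_radialExt hf (sph_ne_zero x)).of_le
    two_le_infty).laplacian_CLM_comp_left]
  rfl

theorem SmoothSph.star {p : ℕ} [NeZero p] {f : Sph p → ℂ} (hf : SmoothSph p f) :
    SmoothSph p (star f) :=
  Complex.conjCLE.toContinuousLinearMap.contDiff.comp_contMDiff hf

theorem harmonics_star {p k : ℕ} [NeZero p] {f : C(Sph p, ℂ)} (hf : f ∈ harmonics p k) :
    star f ∈ harmonics p k := by
  refine ⟨hf.1.star, fun x => ?_⟩
  rw [ContinuousMap.coe_star, sphLaplacian_star hf.1, hf.2]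
  simp

theorem harmonics_apply {p k : ℕ} [NeZero p] {f : C(Sph p, ℂ)} (hf : f ∈ harmonics p k)
    (x : Sph p) : sphLaplacian f x = -(lapEigval p k : ℂ) * f x := by
  rw [hf.2 x]
  simp [lapEigval]

/-- Green's formula multiplies the integral by the difference of two distinct eigenvalues and yields
zero. The pairing is bilinear; `harmonics_star` turns it into the Hermitian one. -/
theorem integral_mul_harmonics_eq_zero {p j k : ℕ} [Fact (2 ≤ p)] (hjk : j ≠ k)
    {f g : C(Sph p, ℂ)} (hf : f ∈ harmonics p j) (hg : g ∈ harmonics p k) :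
    ∫ x, f x * g x ∂surf p = 0 := by
  have h1 := integral_mul_sphLaplacian_comm hf.1 hg.1
  have h2 : ∀ x, f x * sphLaplacian g x - g x * sphLaplacian f x
      = ((lapEigval p j - lapEigval p k : ℝ) : ℂ) * (f x * g x) := fun x => by
    rw [harmonics_apply hf, harmonics_apply hg]
    push_cast
    ring
  simp only [h2, integral_const_mul] at h1
  refine (mul_eq_zero.1 h1).resolve_left (Complex.ofReal_ne_zero.2 (sub_ne_zero.2 ?_))
  exact fun h => hjk ((lapEigval_strictMono Fact.out).injective h)

theorem isOrtho_topologicalClosure_span {E : Type*} [NormedAddCommGroup E]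
    [InnerProductSpace ℂ E] {s t : Set E} (h : ∀ x ∈ s, ∀ y ∈ t, inner ℂ x y = 0) :
    (Submodule.span ℂ s).topologicalClosure ⟂ (Submodule.span ℂ t).topologicalClosure := by
  have h1 : Submodule.span ℂ s ⟂ Submodule.span ℂ t :=
    Submodule.isOrtho_span.2 fun x hx y hy => h x hx y hy
  have h2 : (Submodule.span ℂ s).topologicalClosure ⟂ Submodule.span ℂ t :=
    Submodule.topologicalClosure_minimal _ h1 (Submodule.isClosed_orthogonal _)
  have h3 : (Submodule.span ℂ t).topologicalClosure ⟂ (Submodule.span ℂ s).topologicalClosure :=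
    Submodule.topologicalClosure_minimal _ h2.symm (Submodule.isClosed_orthogonal _)
  exact h3.symm

theorem pairwise_isOrtho_compFst (p q : ℕ) [Fact (2 ≤ p)] :
    Pairwise fun a a' => compFst p q a ⟂ compFst p q a' := by
  intro a a' haa'
  refine isOrtho_topologicalClosure_span ?_
  rintro F ⟨Y, hY, g, hF⟩ F' ⟨Y', hY', g', hF'⟩
  rw [L2.inner_def]
  have h1 : (fun z => inner ℂ (F z) (F' z)) =ᵐ[vol p q]
      fun z => (star Y z.1 * Y' z.1) * (star (g z.2) * g' z.2) := by
    filter_upwards [hF, hF'] with z hz hz'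
    rw [hz, hz']
    simp
    ring
  rw [integral_congr_ae h1, integral_prod_mul (fun x => star Y x * Y' x)
    (fun y => star (g y) * g' y)]
  have h2 := integral_mul_harmonics_eq_zero haa' (harmonics_star hY) hY'
  simp only [ContinuousMap.star_apply] at h2 ⊢
  rw [h2, zero_mul]

theorem pairwise_isOrtho_compSnd (p q : ℕ) [Fact (2 ≤ q)] :
    Pairwise fun b b' => compSnd p q b ⟂ compSnd p q b' := by
  intro b b' hbb'
  refine isOrtho_topologicalClosure_span ?_
  rintro F ⟨g, Z, hZ, hF⟩ F' ⟨g', Z', hZ', hF'⟩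
  rw [L2.inner_def]
  have h1 : (fun z => inner ℂ (F z) (F' z)) =ᵐ[vol p q]
      fun z => (star (g z.1) * g' z.1) * (star Z z.2 * Z' z.2) := by
    filter_upwards [hF, hF'] with z hz hz'
    rw [hz, hz']
    simp
    ring
  rw [integral_congr_ae h1, integral_prod_mul (fun x => star (g x) * g' x)
    (fun y => star Z y * Z' y)]
  have h2 := integral_mul_harmonics_eq_zero hbb' (harmonics_star hZ) hZ'
  simp only [ContinuousMap.star_apply] at h2 ⊢
  rw [h2, mul_zero]

theorem kType_le_compFst (p q : ℕ) [NeZero p] [NeZero q] (k : ℕ × ℕ) :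
    kType p q k.1 k.2 ≤ compFst p q k.1 := by
  refine Submodule.topologicalClosure_mono (Submodule.span_mono ?_)
  rintro F ⟨Y, hY, Z, hZ, hF⟩
  refine ⟨Y, hY, ContinuousMap.toLp 2 (surf q) ℂ Z, hF.trans ?_⟩
  filter_upwards [Measure.quasiMeasurePreserving_snd.ae
    (ContinuousMap.coeFn_toLp (p := 2) (𝕜 := ℂ) (surf q) Z)] with z hz
  rw [hz]

theorem kType_le_compSnd (p q : ℕ) [NeZero p] [NeZero q] (k : ℕ × ℕ) :
    kType p q k.1 k.2 ≤ compSnd p q k.2 := by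
  refine Submodule.topologicalClosure_mono (Submodule.span_mono ?_)
  rintro F ⟨Y, hY, Z, hZ, hF⟩
  refine ⟨ContinuousMap.toLp 2 (surf p) ℂ Y, Z, hZ, hF.trans ?_⟩
  filter_upwards [Measure.quasiMeasurePreserving_fst.ae
    (ContinuousMap.coeFn_toLp (p := 2) (𝕜 := ℂ) (surf p) Y)] with z hz
  rw [hz]

theorem pairwise_isOrtho_kType (p q : ℕ) [Fact (2 ≤ p)] [Fact (2 ≤ q)] :
    Pairwise fun k l : ℕ × ℕ => kType p q k.1 k.2 ⟂ kType p q l.1 l.2 := by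
  intro k l hkl
  by_cases h : k.1 = l.1
  · have h2 : k.2 ≠ l.2 := fun h2 => hkl (Prod.ext h h2)
    exact (pairwise_isOrtho_compSnd p q h2).mono (kType_le_compSnd p q k) (kType_le_compSnd p q l)
  · exact (pairwise_isOrtho_compFst p q h).mono (kType_le_compFst p q k) (kType_le_compFst p q l)

theorem inner_toL2 {p q : ℕ} (f : C(M p q, ℂ)) (F : L2M p q) :
    inner ℂ (toL2 p q f) F = ∫ z, F z * star f z ∂vol p q := by
  rw [L2.inner_def]
  refine integral_congr_ae ?_
  filter_upwards [toL2_coeFn f] with z hz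
  rw [hz]
  simp

/-- A component is determined by pairing with the generators of its K-type. Bilinear pairings
suffice, as the generators are stable under conjugation. -/
theorem kComp_eq_smul {p q a b : ℕ} [NeZero p] [NeZero q] {F G : L2M p q} {c : ℂ}
    (h : ∀ Y ∈ harmonics p a, ∀ Z ∈ harmonics q b,
      ∫ z, G z * tensorHom p q Y Z z ∂vol p q = c * ∫ z, F z * tensorHom p q Y Z z ∂vol p q) :
    kComp a b G = c • kComp a b F := by
  rw [← sub_eq_zero, kComp, kComp, ← map_smul, ← map_sub,
    Submodule.starProjection_apply_eq_zero_iff]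
  have h1 : kType p q a b ≤ (Submodule.span ℂ {G - c • F})ᗮ := by
    refine Submodule.topologicalClosure_minimal _ ?_ (Submodule.isClosed_orthogonal _)
    rw [Submodule.span_le]
    rintro F' ⟨Y, hY, Z, hZ, hF'⟩
    have hF2 : F' = toL2 p q (tensorHom p q Y Z) := 
      Lp.ext (hF'.trans (toL2_coeFn (tensorHom p q Y Z)).symm)
    rw [SetLike.mem_coe, Submodule.mem_orthogonal_singleton_iff_inner_left, hF2, inner_sub_right,
      inner_smul_right, inner_toL2, inner_toL2]
    have := h _ (harmonics_star hY) _ (harmonics_star hZ)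
    have hst : tensorHom p q (star Y) (star Z) = star (tensorHom p q Y Z) := by
      ext z
      simp
    rw [hst] at this
    rw [this, sub_self]
  rw [Submodule.mem_orthogonal]
  intro u hu
  exact Submodule.mem_orthogonal_singleton_iff_inner_left.1 (h1 hu)

end Orthogonality

/-! ## The partial Laplacians on `M` -/

section ProductLaplacian

variable {p q : ℕ}

/-- The extension of a function on `M` to `ℝ^p × ℝ^q`, homogeneous of degree `0` in each
variable. -/
def biradialExt (f : M p q → ℂ) (w : EuclideanSpace ℝ (Fin p) × EuclideanSpace ℝ (Fin q)) : ℂ :=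
  radialExt (fun x => radialExt (fun y => f (x, y)) w.2) w.1

theorem contDiffAt_biradialExt [NeZero p] [NeZero q] {f : M p q → ℂ} (hf : SmoothM p q f)
    {w : EuclideanSpace ℝ (Fin p) × EuclideanSpace ℝ (Fin q)} (h1 : w.1 ≠ 0) (h2 : w.2 ≠ 0) :
    ContDiffAt ℝ ∞ (biradialExt f) w := by
  let U : TopologicalSpace.Opens (EuclideanSpace ℝ (Fin p) × EuclideanSpace ℝ (Fin q)) :=
    ⟨{0}ᶜ ×ˢ {0}ᶜ, isOpen_compl_singleton.prod isOpen_compl_singleton⟩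
  have hU1 : ∀ u : U, u.1.1 ≠ 0 := fun u => u.2.1
  have hU2 : ∀ u : U, u.1.2 ≠ 0 := fun u => u.2.2
  have hn1 : ContMDiff 𝓘(ℝ, EuclideanSpace ℝ (Fin p) × EuclideanSpace ℝ (Fin q))
      𝓘(ℝ, EuclideanSpace ℝ (Fin p)) ∞ (fun u : U => ‖u.1.1‖⁻¹ • u.1.1) := by
    intro u
    refine (contMDiffAt_subtype_iff
      (f := fun w : EuclideanSpace ℝ (Fin p) × EuclideanSpace ℝ (Fin q) => ‖w.1‖⁻¹ • w.1)).2 ?_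
    rw [contMDiffAt_iff_contDiffAt]
    exact ((contDiffAt_fst.norm ℝ (hU1 u)).inv (norm_ne_zero_iff.2 (hU1 u))).smul contDiffAt_fst
  have hn2 : ContMDiff 𝓘(ℝ, EuclideanSpace ℝ (Fin p) × EuclideanSpace ℝ (Fin q))
      𝓘(ℝ, EuclideanSpace ℝ (Fin q)) ∞ (fun u : U => ‖u.1.2‖⁻¹ • u.1.2) := by
    intro u
    refine (contMDiffAt_subtype_iff
      (f := fun w : EuclideanSpace ℝ (Fin p) × EuclideanSpace ℝ (Fin q) => ‖w.2‖⁻¹ • w.2)).2 ?_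
    rw [contMDiffAt_iff_contDiffAt]
    exact ((contDiffAt_snd.norm ℝ (hU2 u)).inv (norm_ne_zero_iff.2 (hU2 u))).smul contDiffAt_snd
  have hs1 := ContMDiff.codRestrict_sphere (n := p - 1) hn1
    (fun u => by simp [norm_smul, hU1 u])
  have hs2 := ContMDiff.codRestrict_sphere (n := q - 1) hn2
    (fun u => by simp [norm_smul, hU2 u])
  have hc : ContMDiff 𝓘(ℝ, EuclideanSpace ℝ (Fin p) × EuclideanSpace ℝ (Fin q)) 𝓘(ℝ, ℂ) ∞
      (fun u : U => biradialExt f u.1) := by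
    convert ContMDiff.comp hf (hs1.prodMk hs2) using 1
    funext u
    simp only [biradialExt, radialExt, dif_pos (hU1 u), dif_pos (hU2 u), Function.comp]
    rfl
  rw [← contMDiffAt_iff_contDiffAt]
  exact (contMDiffAt_subtype_iff (U := U) (x := ⟨w, h1, h2⟩)).1 (hc ⟨w, h1, h2⟩)

/-- `lapFst` is defined slice by slice. Expressing it through derivatives of one jointly smooth
function makes it continuous on `M`, as needed for Fubini and for membership in `L²`. -/
theorem lapFst_eq_sum [NeZero p] [NeZero q] {f : M p q → ℂ} (hf : SmoothM p q f) (z : M p q) :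
    lapFst f z = ∑ i : Fin p, fderiv ℝ (fderiv ℝ (biradialExt f))
      ((z.1 : EuclideanSpace ℝ (Fin p)), (z.2 : EuclideanSpace ℝ (Fin q)))
      (stdVec i, 0) (stdVec i, 0) := by
  have hy := sph_ne_zero z.2
  set y := (z.2 : EuclideanSpace ℝ (Fin q)) with hyd
  have h1 : radialExt (fun x => f (x, z.2)) = fun w => biradialExt f (w, y) := by
    funext w
    simp only [biradialExt]
    congr 1
    funext x
    rw [hyd, radialExt_coe (fun y => f (x, y))]
  have hmk : ∀ w : EuclideanSpace ℝ (Fin p), HasFDerivAt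
      (fun w : EuclideanSpace ℝ (Fin p) => (w, y))
      (ContinuousLinearMap.inl ℝ (EuclideanSpace ℝ (Fin p)) (EuclideanSpace ℝ (Fin q))) w :=
    fun w => hasFDerivAt_prodMk_left w y
  have h2 : ∀ w : EuclideanSpace ℝ (Fin p), w ≠ 0 →
      fderiv ℝ (radialExt (fun x => f (x, z.2))) w
        = (fderiv ℝ (biradialExt f) (w, y)).comp (ContinuousLinearMap.inl ℝ _ _) := by
    intro w hw
    rw [h1]
    exact (((contDiffAt_biradialExt hf (w := (w, y)) hw hy).differentiableAt
      (by simp)).hasFDerivAt.comp w (hmk w)).fderiv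
  have hx := sph_ne_zero z.1
  have h3 : ∀ i, fderiv ℝ (fun w => fderiv ℝ (radialExt (fun x => f (x, z.2))) w (stdVec i))
      (z.1 : EuclideanSpace ℝ (Fin p)) (stdVec i) = fderiv ℝ (fderiv ℝ (biradialExt f))
      ((z.1 : EuclideanSpace ℝ (Fin p)), y) (stdVec i, 0) (stdVec i, 0) := by
    intro i
    have he : (fun w => fderiv ℝ (radialExt (fun x => f (x, z.2))) w (stdVec i))
        =ᶠ[nhds (z.1 : EuclideanSpace ℝ (Fin p))]
        fun w => fderiv ℝ (biradialExt f) (w, y) (stdVec i, 0) := by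
      filter_upwards [isOpen_compl_singleton.mem_nhds hx] with w hw
      rw [h2 w hw]
      simp
    rw [he.fderiv_eq]
    have hd : HasFDerivAt (fderiv ℝ (biradialExt f)) _
        ((z.1 : EuclideanSpace ℝ (Fin p)), y) :=
      (((contDiffAt_biradialExt hf (w := ((z.1 : EuclideanSpace ℝ (Fin p)), y)) hx
        hy).fderiv_right (m := ∞) (by simp)).differentiableAt (by simp)).hasFDerivAt
    have hd2 := (hd.comp (z.1 : EuclideanSpace ℝ (Fin p)) (hmk _)).clm_apply
      (hasFDerivAt_const ((stdVec i, 0) : EuclideanSpace ℝ (Fin p) × EuclideanSpace ℝ (Fin q)) _)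
    have := congrArg (fun T => T (stdVec i)) hd2.fderiv
    simpa using this
  rw [lapFst, sphLaplacian, laplacian_eq_sum_fderiv_fderiv]
  · exact Finset.sum_congr rfl fun i _ => h3 i
  · have : ContDiffAt ℝ ∞ (fderiv ℝ (radialExt (fun x => f (x, z.2))))
        (z.1 : EuclideanSpace ℝ (Fin p)) :=
      (contDiffAt_radialExt (hf.slice_fst z.2) hx).fderiv_right (by simp)
    exact this.differentiableAt (by simp)

theorem SmoothM.continuous_lapFst [NeZero p] [NeZero q] {f : M p q → ℂ} (hf : SmoothM p q f) :
    Continuous (lapFst f) := by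
  rw [funext (lapFst_eq_sum hf)]
  refine continuous_finsetSum _ fun i _ => continuous_iff_continuousAt.2 fun z => ?_
  have h1 : ContDiffAt ℝ ∞ (fderiv ℝ (fderiv ℝ (biradialExt f)))
      ((z.1 : EuclideanSpace ℝ (Fin p)), (z.2 : EuclideanSpace ℝ (Fin q))) :=
    ((contDiffAt_biradialExt hf (sph_ne_zero z.1) (sph_ne_zero z.2)).fderiv_right (m := ∞)
      (by simp)).fderiv_right (by simp)
  have h2 : ContinuousAt (fun z : M p q =>
      ((z.1 : EuclideanSpace ℝ (Fin p)), (z.2 : EuclideanSpace ℝ (Fin q)))) z := by fun_prop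
  have h3 := ContinuousAt.comp (f := fun z : M p q =>
      ((z.1 : EuclideanSpace ℝ (Fin p)), (z.2 : EuclideanSpace ℝ (Fin q)))) h1.continuousAt h2
  exact (h3.clm_apply continuousAt_const).clm_apply continuousAt_const

theorem SmoothM.swap [NeZero p] [NeZero q] {f : M p q → ℂ} (hf : SmoothM p q f) :
    SmoothM q p (f ∘ Prod.swap) :=
  ContMDiff.comp hf (contMDiff_snd.prodMk contMDiff_fst)

theorem SmoothM.continuous_lapSnd [NeZero p] [NeZero q] {f : M p q → ℂ} (hf : SmoothM p q f) :
    Continuous (lapSnd f) := by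
  have h : lapSnd f = lapFst (f ∘ Prod.swap) ∘ Prod.swap := rfl
  rw [h]
  exact hf.swap.continuous_lapFst.comp continuous_swap

theorem SmoothM.continuous [NeZero p] [NeZero q] {f : M p q → ℂ} (hf : SmoothM p q f) :
    Continuous f :=
  ContMDiff.continuous hf

theorem SmoothM.continuous_yamabe [NeZero p] [NeZero q] {f : M p q → ℂ} (hf : SmoothM p q f) :
    Continuous (yamabe f) :=
  (hf.continuous_lapFst.sub hf.continuous_lapSnd).sub (continuous_const.mul hf.continuous)

theorem integrable_vol {f : M p q → ℂ} (hf : Continuous f) : Integrable f (vol p q) :=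
  hf.integrable_of_hasCompactSupport (HasCompactSupport.of_compactSpace f)

theorem integral_mul_lapFst_comm [NeZero p] [NeZero q] {f g : M p q → ℂ} (hf : SmoothM p q f)
    (hg : SmoothM p q g) :
    ∫ z, f z * lapFst g z ∂vol p q = ∫ z, g z * lapFst f z ∂vol p q := by
  have h1 : Continuous fun z => f z * lapFst g z := hf.continuous.mul hg.continuous_lapFst
  have h2 : Continuous fun z => g z * lapFst f z := hg.continuous.mul hf.continuous_lapFst
  rw [← sub_eq_zero, ← integral_sub (integrable_vol h1) (integrable_vol h2)]
  refine (integral_prod_symm _ (integrable_vol (h1.sub h2))).trans ?_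
  simp only [Pi.sub_apply, lapFst]
  simp only [integral_mul_sphLaplacian_comm (hf.slice_fst _) (hg.slice_fst _), integral_zero]

theorem integral_mul_lapSnd_comm [NeZero p] [NeZero q] {f g : M p q → ℂ} (hf : SmoothM p q f)
    (hg : SmoothM p q g) :
    ∫ z, f z * lapSnd g z ∂vol p q = ∫ z, g z * lapSnd f z ∂vol p q := by
  have h1 : Continuous fun z => f z * lapSnd g z := hf.continuous.mul hg.continuous_lapSnd
  have h2 : Continuous fun z => g z * lapSnd f z := hg.continuous.mul hf.continuous_lapSnd
  rw [← sub_eq_zero, ← integral_sub (integrable_vol h1) (integrable_vol h2)]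
  refine (integral_prod _ (integrable_vol (h1.sub h2))).trans ?_
  simp only [Pi.sub_apply, lapSnd]
  simp only [integral_mul_sphLaplacian_comm (hf.slice_snd _) (hg.slice_snd _), integral_zero]

theorem integral_mul_yamabe_comm [NeZero p] [NeZero q] {f g : M p q → ℂ} (hf : SmoothM p q f)
    (hg : SmoothM p q g) :
    ∫ z, f z * yamabe g z ∂vol p q = ∫ z, g z * yamabe f z ∂vol p q := by
  have key : ∀ {f g : M p q → ℂ}, SmoothM p q f → SmoothM p q g →
      ∫ z, f z * yamabe g z ∂vol p q = ∫ z, f z * lapFst g z ∂vol p q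
        - ∫ z, f z * lapSnd g z ∂vol p q
        - ∫ z, (((((p : ℝ) + q - 2) - 2) / (4 * (((p : ℝ) + q - 2) - 1))
          * scalarCurvature p q : ℝ) : ℂ) * (f z * g z) ∂vol p q := by
    intro f g hf hg
    rw [← integral_sub, ← integral_sub]
    · refine integral_congr_ae (Filter.Eventually.of_forall fun z => ?_)
      simp only [yamabe]
      ring
    · exact integrable_vol ((hf.continuous.mul hg.continuous_lapFst).sub
        (hf.continuous.mul hg.continuous_lapSnd))
    · exact integrable_vol (continuous_const.mul (hf.continuous.mul hg.continuous))
    · exact integrable_vol (hf.continuous.mul hg.continuous_lapFst)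
    · exact integrable_vol (hf.continuous.mul hg.continuous_lapSnd)
  rw [key hf hg, key hg hf, integral_mul_lapFst_comm hf hg, integral_mul_lapSnd_comm hf hg]
  simp only [mul_comm (f _) (g _)]

theorem smoothM_tensorHom [NeZero p] [NeZero q] {Y : C(Sph p, ℂ)} {Z : C(Sph q, ℂ)}
    (hY : SmoothSph p Y) (hZ : SmoothSph q Z) : SmoothM p q (tensorHom p q Y Z) := by
  have h1 : ContMDiff ((𝓡 (p - 1)).prod (𝓡 (q - 1))) 𝓘(ℝ, ℂ) ∞ fun z : M p q => Y z.1 :=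
    ContMDiff.comp hY contMDiff_fst
  have h2 : ContMDiff ((𝓡 (p - 1)).prod (𝓡 (q - 1))) 𝓘(ℝ, ℂ) ∞ fun z : M p q => Z z.2 :=
    ContMDiff.comp hZ contMDiff_snd
  exact (contDiff_mul (𝕜 := ℝ) (𝔸 := ℂ)).comp_contMDiff (h1.prodMk_space h2)

theorem lapFst_tensorHom [NeZero p] [NeZero q] {a : ℕ} {Y : C(Sph p, ℂ)}
    (hY : Y ∈ harmonics p a) (Z : C(Sph q, ℂ)) (z : M p q) :
    lapFst (tensorHom p q Y Z) z = -(lapEigval p a : ℂ) * tensorHom p q Y Z z := by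
  have : (fun x => tensorHom p q Y Z (x, z.2)) = Z z.2 • (Y : Sph p → ℂ) := by
    funext x
    simp [mul_comm]
  rw [lapFst, this, sphLaplacian_smul _ hY.1, harmonics_apply hY, tensorHom_apply]
  ring

theorem lapSnd_tensorHom [NeZero p] [NeZero q] {b : ℕ} (Y : C(Sph p, ℂ)) {Z : C(Sph q, ℂ)}
    (hZ : Z ∈ harmonics q b) (z : M p q) :
    lapSnd (tensorHom p q Y Z) z = -(lapEigval q b : ℂ) * tensorHom p q Y Z z := by
  have : (fun y => tensorHom p q Y Z (z.1, y)) = Y z.1 • (Z : Sph q → ℂ) := by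
    funext y
    simp
  rw [lapSnd, this, sphLaplacian_smul _ hZ.1, harmonics_apply hZ, tensorHom_apply]
  ring

theorem yamabe_tensorHom [Fact (2 ≤ p)] [Fact (2 ≤ q)] {a b : ℕ} {Y : C(Sph p, ℂ)}
    {Z : C(Sph q, ℂ)} (hY : Y ∈ harmonics p a) (hZ : Z ∈ harmonics q b) (z : M p q) :
    yamabe (tensorHom p q Y Z) z
      = ((eigval q b ^ 2 - eigval p a ^ 2 : ℝ) : ℂ) * tensorHom p q Y Z z := by
  have h2p : (2 : ℝ) ≤ p := by exact_mod_cast (Fact.out : 2 ≤ p)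
  have h2q : (2 : ℝ) ≤ q := by exact_mod_cast (Fact.out : 2 ≤ q)
  have hne : (p : ℝ) + q - 2 - 1 ≠ 0 := by linarith
  -- Completing the square gives `a(a+p-2) = λ_a² - (p-2)²/4`. The scalar curvature factors as
  -- `(p-q)(p+q-3)`, so the constant is `((p-2)² - (q-2)²)/4`, exactly what cancels the leftovers.
  have h : -lapEigval p a + lapEigval q b - (((p : ℝ) + q - 2) - 2) / (4 * (((p : ℝ) + q - 2) - 1))
      * scalarCurvature p q = eigval q b ^ 2 - eigval p a ^ 2 := by
    unfold lapEigval scalarCurvature eigval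
    field_simp
    ring
  rw [← h, yamabe, lapFst_tensorHom hY, lapSnd_tensorHom _ hZ]
  push_cast
  ring

theorem yamabe_star [NeZero p] [NeZero q] {f : M p q → ℂ} (hf : SmoothM p q f) (z : M p q) :
    yamabe (star f) z = star (yamabe f z) := by
  have h1 := sphLaplacian_star (hf.slice_fst z.2) z.1
  have h2 := sphLaplacian_star (hf.slice_snd z.1) z.2
  change sphLaplacian (star fun x => f (x, z.2)) z.1 - sphLaplacian (star fun y => f (z.1, y)) z.2
    - _ * star (f z) = _
  rw [h1, h2]
  simp [yamabe, lapFst, lapSnd]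

theorem SmoothM.star [NeZero p] [NeZero q] {f : M p q → ℂ} (hf : SmoothM p q f) :
    SmoothM p q (star f) :=
  Complex.conjCLE.toContinuousLinearMap.contDiff.comp_contMDiff hf

end ProductLaplacian

/-! ## Components of smooth functions and of weak solutions -/

section Components

variable {p q : ℕ}

theorem integral_toL2_mul (f : C(M p q, ℂ)) (g : M p q → ℂ) :
    ∫ z, toL2 p q f z * g z ∂vol p q = ∫ z, f z * g z ∂vol p q := by
  refine integral_congr_ae ?_
  filter_upwards [toL2_coeFn f] with z hz
  rw [hz]

theorem eigval_eq_iff {a b : ℕ} : eigval p a = eigval q b ↔ 2 * a + p = 2 * b + q := by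
  unfold eigval
  constructor
  · intro h
    have : (2 * a + p : ℝ) = 2 * b + q := by linarith
    exact_mod_cast this
  · intro h
    have : (2 * a + p : ℝ) = 2 * b + q := by exact_mod_cast h
    linarith

variable [Fact (2 ≤ p)] [Fact (2 ≤ q)]

/-- Symmetry moves the Laplacian onto the test product of harmonics, which is an eigenfunction.
`kComp_yamabe` works the same way. -/
theorem kComp_lapFst {f : C(M p q, ℂ)} (hf : SmoothM p q f) (a b : ℕ) :
    kComp a b (toL2 p q ⟨lapFst f, hf.continuous_lapFst⟩)
      = -(lapEigval p a : ℂ) • kComp a b (toL2 p q f) := by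
  refine kComp_eq_smul fun Y hY Z hZ => ?_
  rw [integral_toL2_mul, integral_toL2_mul, ← integral_const_mul]
  simp only [ContinuousMap.coe_mk, mul_comm (lapFst f _)]
  rw [integral_mul_lapFst_comm (smoothM_tensorHom hY.1 hZ.1) hf]
  simp only [lapFst_tensorHom hY]
  exact integral_congr_ae (Filter.Eventually.of_forall fun z => by ring)

theorem kComp_yamabe {f : C(M p q, ℂ)} (hf : SmoothM p q f) (a b : ℕ) :
    kComp a b (toL2 p q ⟨yamabe f, hf.continuous_yamabe⟩)
      = ((eigval q b ^ 2 - eigval p a ^ 2 : ℝ) : ℂ) • kComp a b (toL2 p q f) := by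
  refine kComp_eq_smul fun Y hY Z hZ => ?_
  rw [integral_toL2_mul, integral_toL2_mul, ← integral_const_mul]
  simp only [ContinuousMap.coe_mk, mul_comm (yamabe f _)]
  rw [integral_mul_yamabe_comm (smoothM_tensorHom hY.1 hZ.1) hf]
  simp only [yamabe_tensorHom hY hZ]
  exact integral_congr_ae (Filter.Eventually.of_forall fun z => by ring)

theorem eigval_nonneg (a : ℕ) : 0 ≤ eigval p a := by
  have h2p : (2 : ℝ) ≤ p := by exact_mod_cast (Fact.out : 2 ≤ p)
  have := Nat.cast_nonneg (α := ℝ) a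
  unfold eigval
  linarith

theorem eigval_sq_sub_ne_zero {a b : ℕ} (h : 2 * a + p ≠ 2 * b + q) :
    ((eigval q b ^ 2 - eigval p a ^ 2 : ℝ) : ℂ) ≠ 0 := by
  rw [Complex.ofReal_ne_zero, sub_ne_zero]
  intro h2
  rw [sq_eq_sq₀ (eigval_nonneg _) (eigval_nonneg _)] at h2
  exact h (eigval_eq_iff.1 h2.symm)

theorem kComp_eq_zero_of_mem_V {f : C(M p q, ℂ)} (hf : f ∈ V p q) {a b : ℕ}
    (h : 2 * a + p ≠ 2 * b + q) : kComp a b (toL2 p q f) = 0 := by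
  have h1 := kComp_yamabe hf.1 a b
  have h2 : (⟨yamabe f, hf.1.continuous_yamabe⟩ : C(M p q, ℂ)) = 0 := by
    ext z
    exact hf.2 z
  rw [h2, map_zero, kComp, map_zero] at h1
  exact (smul_eq_zero.1 h1.symm).resolve_left (eigval_sq_sub_ne_zero h)

theorem tensorHom_mem_V {a b : ℕ} (h : 2 * a + p = 2 * b + q) {Y : C(Sph p, ℂ)}
    {Z : C(Sph q, ℂ)} (hY : Y ∈ harmonics p a) (hZ : Z ∈ harmonics q b) :
    tensorHom p q Y Z ∈ V p q := by
  refine ⟨smoothM_tensorHom hY.1 hZ.1, fun z => ?_⟩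
  rw [yamabe_tensorHom hY hZ, eigval_eq_iff.2 h]
  simp

/-- Both `f` and its first Laplacian are in `L²`, so the squares `‖P_a f‖²` are summable even with
the weight `lapEigval p a ^ 2`, which is at least `a`. -/
theorem toL2_mem_domDp {f : C(M p q, ℂ)} (hf : SmoothM p q f) : toL2 p q f ∈ domDp p q := by
  have h1 := starProjection_coarse_eq (c := fun a => -(lapEigval p a : ℂ))
    (pairwise_isOrtho_compFst p q) (kType_le_compFst p q) (iSup_kType_topologicalClosure p q)
    (fun k => kComp_lapFst hf k.1 k.2)
  have h2 := summable_norm_sq_starProjection (pairwise_isOrtho_compFst p q) (toL2 p q f)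
  have h3 := summable_norm_sq_starProjection (pairwise_isOrtho_compFst p q)
    (toL2 p q ⟨lapFst f, hf.continuous_lapFst⟩)
  simp only [h1, norm_smul, mul_pow, norm_neg, Complex.norm_real, Real.norm_eq_abs, sq_abs] at h3
  refine Summable.of_nonneg_of_le (fun a => mul_nonneg (eigval_nonneg a) (sq_nonneg _))
    (fun a => ?_) ((h2.mul_left (((p : ℝ) - 2) / 2)).add h3)
  rw [← add_mul]
  refine mul_le_mul_of_nonneg_right ?_ (sq_nonneg _)
  have h2p : (2 : ℝ) ≤ p := by exact_mod_cast (Fact.out : 2 ≤ p)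
  unfold eigval lapEigval
  have : (a : ℝ) ≤ (a * (a + p - 2)) ^ 2 := by
    rcases Nat.eq_zero_or_pos a with rfl | ha
    · simp
    · have ha : (1 : ℝ) ≤ a := by exact_mod_cast ha
      have h4 : (a : ℝ) ≤ a * (a + p - 2) := by nlinarith
      nlinarith
  linarith

/-- Products of harmonics are admissible test functions and Yamabe eigenfunctions, with nonzero
eigenvalue off the diagonal. -/
theorem kComp_eq_zero_of_weakYamabeZero {F : L2M p q} (hF : WeakYamabeZero F) {a b : ℕ}
    (h : 2 * a + p ≠ 2 * b + q) : kComp a b F = 0 := by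
  have : kComp a b F = (0 : ℂ) • kComp a b F := by
    refine kComp_eq_smul fun Y hY Z hZ => ?_
    have h1 := hF _ (smoothM_tensorHom hY.1 hZ.1)
    simp only [yamabe_tensorHom hY hZ] at h1
    rw [zero_mul]
    refine (mul_eq_zero.1 ?_).resolve_left (eigval_sq_sub_ne_zero h)
    rw [← integral_const_mul, ← h1]
    exact integral_congr_ae (Filter.Eventually.of_forall fun z => by ring)
  rw [this, zero_smul]

/-- Pair `F` with the Yamabe image of a test function K-type by K-type: off the diagonal the
component of `F` vanishes, on it that of the Yamabe image does. -/
theorem weakYamabeZero_of_kComp_eq_zero {F : L2M p q}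
    (hF : ∀ a b : ℕ, 2 * a + p ≠ 2 * b + q → kComp a b F = 0) : WeakYamabeZero F := by
  intro φ hφ
  -- The test function is conjugated because the weak equation is bilinear while the inner product
  -- is Hermitian.
  set ψ : C(M p q, ℂ) := ⟨star φ, hφ.star.continuous⟩ with hψ
  have hψs : SmoothM p q ψ := hφ.star
  set N := toL2 p q ⟨yamabe ψ, hψs.continuous_yamabe⟩ with hN
  have h1 : inner ℂ N F = ∫ z, F z * yamabe φ z ∂vol p q := by
    rw [inner_toL2]
    refine integral_congr_ae (Filter.Eventually.of_forall fun z => ?_)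
    change F z * star (yamabe (star φ) z) = _
    rw [yamabe_star hφ, star_star]
  rw [← h1]
  have h2 := (hasSum_starProjection (pairwise_isOrtho_kType p q)
    (iSup_kType_topologicalClosure p q) F).mapL (innerSL ℂ N)
  refine h2.unique ?_
  convert hasSum_zero with k
  rw [innerSL_apply_apply]
  by_cases hk : 2 * k.1 + p = 2 * k.2 + q
  · have h3 : kComp k.1 k.2 N = 0 := by
      rw [hN, kComp_yamabe hψs, eigval_eq_iff.2 hk]
      simp
    rw [← Submodule.inner_starProjection_left_eq_right]
    change inner ℂ (kComp k.1 k.2 N) F = 0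
    rw [h3, inner_zero_left]
  · change inner ℂ N (kComp k.1 k.2 F) = 0
    rw [hF _ _ hk, inner_zero_right]

end Components

/-! ## The Hilbert completion of `V^{p,q}` -/

section Main

variable {p q : ℕ}

theorem unitaryForm_eq_inner [NeZero p] [NeZero q] (f g : V p q) :
    unitaryForm p q f g = inner ℂ (Dp (toL2 p q g)) (Dp (toL2 p q f)) := by
  rw [L2.inner_def]
  rfl

/-- The inclusion of `V^{p,q}` in `L²(M)`. -/
def inclV (p q : ℕ) [NeZero p] [NeZero q] : V p q →ₗ[ℂ] L2M p q :=
  (toL2 p q).toLinearMap ∘ₗ (V p q).subtype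

/-- The indices `(a, b)` of the `K`-types that occur in `V^{p,q}`. -/
def diagIndex (p q : ℕ) : Set (ℕ × ℕ) := {k | 2 * k.1 + p = 2 * k.2 + q}

theorem hasSum_diagIndex {E : Type*} [AddCommMonoid E] [TopologicalSpace E] {f : ℕ × ℕ → E} {x : E}
    (h : HasSum f x) (h0 : ∀ k ∉ diagIndex p q, f k = 0) :
    HasSum (fun k : {k : ℕ × ℕ // 2 * k.1 + p = 2 * k.2 + q} => f k.1) x :=
  (hasSum_subtype_iff_of_support_subset (s := diagIndex p q) fun k hk => by
    by_contra hk'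
    exact hk (h0 k hk')).2 h

variable [Fact (2 ≤ p)] [Fact (2 ≤ q)]

/-- On the diagonal `2a + p = 2` would force `a = b = 0` and `p = q = 2`, so `2a + p ≥ 3`. When `p =
q = 2` the bound fails: constants have `λ_0 = 0`, so the form is degenerate on them. -/
theorem half_le_eigval (hpq : (p, q) ≠ (2, 2)) {k : ℕ × ℕ} (hk : k ∈ diagIndex p q) :
    1 / 2 ≤ eigval p k.1 := by
  have h1 : 2 ≤ p := Fact.out
  have h2 : 2 ≤ q := Fact.out
  have h3 : 2 * k.1 + p = 2 * k.2 + q := hk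
  have h4 : 3 ≤ 2 * k.1 + p := by
    by_contra! h
    exact hpq (Prod.ext (by simp; omega) (by simp; omega))
  have h5 : (3 : ℝ) ≤ 2 * k.1 + p := by exact_mod_cast h4
  unfold eigval
  linarith

theorem Dp_spec {F : L2M p q} (hF : F ∈ domDp p q) (k : ℕ × ℕ) :
    (kType p q k.1 k.2).starProjection (Dp F)
      = ((Real.sqrt (eigval p k.1) : ℝ) : ℂ) • (kType p q k.1 k.2).starProjection F :=
  starProjection_diagOp (K := fun k : ℕ × ℕ => kType p q k.1 k.2) (π := Prod.fst)
    (pairwise_isOrtho_compFst p q) (kType_le_compFst p q) eigval_nonneg hF k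

theorem Dq_spec {F : L2M p q} (hF : F ∈ domDq p q) (k : ℕ × ℕ) :
    (kType p q k.1 k.2).starProjection (Dq F)
      = ((Real.sqrt (eigval q k.2) : ℝ) : ℂ) • (kType p q k.1 k.2).starProjection F :=
  starProjection_diagOp (K := fun k : ℕ × ℕ => kType p q k.1 k.2) (π := Prod.snd)
    (pairwise_isOrtho_compSnd p q) (kType_le_compSnd p q) eigval_nonneg hF k

/-- The two multipliers agree on the diagonal, so `Dp F` already has the components required of `Dq
F`. -/
theorem mem_domDq_and_Dq_eq {F : L2M p q} (hF : F ∈ domDp p q)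
    (h : ∀ k ∉ diagIndex p q, (kType p q k.1 k.2).starProjection F = 0) :
    F ∈ domDq p q ∧ Dq F = Dp F :=
  mem_diagDom_and_diagOp_eq (K := fun k : ℕ × ℕ => kType p q k.1 k.2) (π := Prod.snd)
    (pairwise_isOrtho_compSnd p q) (kType_le_compSnd p q) (iSup_kType_topologicalClosure p q)
    eigval_nonneg fun k => by
      rw [Dp_spec hF]
      by_cases hk : k ∈ diagIndex p q
      · rw [eigval_eq_iff.2 hk]
      · rw [h k hk, smul_zero, smul_zero]

theorem kComp_eq_zero_of_Dp_eq_Dq {F : L2M p q} (hp : F ∈ domDp p q) (hq : F ∈ domDq p q)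
    (h : Dp F = Dq F) {k : ℕ × ℕ} (hk : k ∉ diagIndex p q) :
    (kType p q k.1 k.2).starProjection F = 0 := by
  have h1 := Dp_spec hp k
  rw [h, Dq_spec hq, ← sub_eq_zero, ← sub_smul] at h1
  refine (smul_eq_zero.1 h1).resolve_left ?_
  rw [← Complex.ofReal_sub, Complex.ofReal_eq_zero, sub_eq_zero]
  intro h2
  rw [Real.sqrt_inj (eigval_nonneg _) (eigval_nonneg _)] at h2
  exact hk (eigval_eq_iff.1 h2.symm)

/-- For a diagonal index the generating products solve the Yamabe equation, so the span whose
closure is the K-type already lies in `V`. -/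
theorem kType_le_closure_range {k : ℕ × ℕ} (hk : k ∈ diagIndex p q) :
    kType p q k.1 k.2
      ≤ (LinearMap.range (inclV p q) ⊓ kType p q k.1 k.2).topologicalClosure := by
  refine Submodule.topologicalClosure_mono ?_
  rw [Submodule.span_le]
  rintro F ⟨Y, hY, Z, hZ, hF⟩
  have h : F = toL2 p q (tensorHom p q Y Z) :=
    Lp.ext (hF.trans (toL2_coeFn (tensorHom p q Y Z)).symm)
  rw [h]
  exact ⟨⟨⟨_, tensorHom_mem_V hk hY hZ⟩, rfl⟩, toL2_tensorHom_mem_kType hY hZ⟩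


theorem inclV_mem_diagDom (f : V p q) :
    inclV p q f ∈ diagDom (eigval p) (compFst p q) :=
  toL2_mem_domDp f.2.1

theorem unitaryForm_eq_inner_diagOp (f g : V p q) :
    unitaryForm p q f g = inner ℂ (diagOp (eigval p) (compFst p q) (inclV p q g))
      (diagOp (eigval p) (compFst p q) (inclV p q f)) :=
  unitaryForm_eq_inner f g

theorem exists_completion (p q : ℕ) [Fact (2 ≤ p)] [Fact (2 ≤ q)] :
    ∃ (H : Type) (_ : NormedAddCommGroup H) (_ : InnerProductSpace ℂ H) (ι : V p q →ₗ[ℂ] H),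
      IsHilbertCompletion (unitaryForm p q) ι :=
  exists_isHilbertCompletion (W := V p q) (τ := inclV p q) (α := eigval p) (P := compFst p q)
    (K := fun k : ℕ × ℕ => kType p q k.1 k.2) (π := Prod.fst)
    (pairwise_isOrtho_compFst p q) (kType_le_compFst p q) (iSup_kType_topologicalClosure p q)
    eigval_nonneg (fun f => by with_reducible_and_instances exact inclV_mem_diagDom f)
    (fun f g => by with_reducible_and_instances exact unitaryForm_eq_inner_diagOp f g)

theorem starProjection_inclV (f : V p q) {k : ℕ × ℕ} (hk : k ∉ diagIndex p q) :
    (kType p q k.1 k.2).starProjection (inclV p q f) = 0 :=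
  kComp_eq_zero_of_mem_V f.2 hk

theorem exists_embedding_completion (hpq : (p, q) ≠ (2, 2)) {H : Type*} [NormedAddCommGroup H]
    [InnerProductSpace ℂ H] {ι : V p q →ₗ[ℂ] H}
    (hι : IsHilbertCompletion (unitaryForm p q) ι) :
    ∃ j : H →L[ℂ] L2M p q, (∀ f, j (ι f) = inclV p q f) ∧ Function.Injective j ∧
      (∀ h, (∀ k ∉ diagIndex p q, (kType p q k.1 k.2).starProjection (j h) = 0) ∧
        j h ∈ domDp p q ∧ ‖Dp (j h)‖ = ‖h‖) ∧
      ∀ F ∈ domDp p q, (∀ k ∉ diagIndex p q, (kType p q k.1 k.2).starProjection F = 0) →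
        F ∈ Set.range j := by
  obtain ⟨j, hj, hinj, hprop, hsurj⟩ := exists_embedding_of_isHilbertCompletion
    (W := V p q) (τ := inclV p q) (α := eigval p) (P := compFst p q)
    (K := fun k : ℕ × ℕ => kType p q k.1 k.2) (π := Prod.fst) (S := diagIndex p q)
    (pairwise_isOrtho_kType p q) (pairwise_isOrtho_compFst p q)
    (kType_le_compFst p q) (iSup_kType_topologicalClosure p q) eigval_nonneg
    (fun f => by with_reducible_and_instances exact inclV_mem_diagDom f)
    (fun f k hk => by with_reducible_and_instances exact starProjection_inclV f hk)
    (fun k hk => by with_reducible_and_instances exact kType_le_closure_range hk)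
    (c := 1 / 2) (by norm_num)
    (fun k hk => half_le_eigval hpq hk)
    (fun f g => by with_reducible_and_instances exact unitaryForm_eq_inner_diagOp f g) hι
  exact ⟨j, hj, hinj, hprop, hsurj⟩

theorem norm_sq_eq_quarter_norm_add_self_sq {E : Type*} [NormedAddCommGroup E]
    [InnerProductSpace ℂ E] (x : E) : ‖x‖ ^ 2 = 1 / 4 * ‖x + x‖ ^ 2 := by
  rw [← two_smul ℂ, norm_smul, mul_pow]
  norm_num
  ring

theorem norm_sq_Dp_eq {F : L2M p q} (hF : F ∈ domDp p q)
    (h : ∀ k ∉ diagIndex p q, (kType p q k.1 k.2).starProjection F = 0) :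
    ‖Dp F‖ ^ 2 = 1 / 4 * ‖Dp F + Dq F‖ ^ 2 := by
  have h1 := (mem_domDq_and_Dq_eq hF h).2
  rw [h1]
  exact norm_sq_eq_quarter_norm_add_self_sq _

theorem hasSum_kComp (F : L2M p q) : HasSum (fun k : ℕ × ℕ => kComp k.1 k.2 F) F :=
  hasSum_starProjection (K := fun k : ℕ × ℕ => kType p q k.1 k.2)
    (pairwise_isOrtho_kType p q) (iSup_kType_topologicalClosure p q) F

theorem hasSum_diagIndex_kComp {F : L2M p q}
    (h0 : ∀ k ∉ diagIndex p q, kComp k.1 k.2 F = 0) :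
    HasSum (fun k : {k : ℕ × ℕ // 2 * k.1 + p = 2 * k.2 + q} => kComp k.1.1 k.1.2 F) F :=
  hasSum_diagIndex (f := fun k : ℕ × ℕ => kComp k.1 k.2 F) (hasSum_kComp F) h0

theorem hasSum_norm_sq_kComp (F : L2M p q) :
    HasSum (fun k : ℕ × ℕ => ‖kComp k.1 k.2 F‖ ^ 2) (‖F‖ ^ 2) :=
  hasSum_norm_sq_starProjection (K := fun k : ℕ × ℕ => kType p q k.1 k.2)
    (pairwise_isOrtho_kType p q) (iSup_kType_topologicalClosure p q) F

theorem kComp_Dp {F : L2M p q} (hF : F ∈ domDp p q) (k : ℕ × ℕ) :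
    kComp k.1 k.2 (Dp F) = ((Real.sqrt (eigval p k.1) : ℝ) : ℂ) • kComp k.1 k.2 F :=
  Dp_spec hF k

theorem norm_sq_kComp_Dp {F : L2M p q} (hF : F ∈ domDp p q) (k : ℕ × ℕ) :
    ‖kComp k.1 k.2 (Dp F)‖ ^ 2 = eigval p k.1 * ‖kComp k.1 k.2 F‖ ^ 2 := by
  rw [kComp_Dp hF, norm_smul, mul_pow, Complex.norm_real, Real.norm_eq_abs, sq_abs,
    Real.sq_sqrt (eigval_nonneg _)]

theorem hasSum_diagIndex_Dp {F : L2M p q} (hF : F ∈ domDp p q)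
    (h0 : ∀ k ∉ diagIndex p q, kComp k.1 k.2 F = 0) :
    HasSum (fun k : {k : ℕ × ℕ // 2 * k.1 + p = 2 * k.2 + q} =>
      ((Real.sqrt (eigval p k.1.1) : ℝ) : ℂ) • kComp k.1.1 k.1.2 F) (Dp F) := by
  have h := hasSum_kComp (Dp F)
  rw [funext (kComp_Dp hF)] at h
  exact hasSum_diagIndex (f := fun k : ℕ × ℕ =>
    ((Real.sqrt (eigval p k.1) : ℝ) : ℂ) • kComp k.1 k.2 F) h fun k hk => by
      rw [h0 k hk, smul_zero]

theorem hasSum_diagIndex_norm_sq {F : L2M p q} (hF : F ∈ domDp p q)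
    (h0 : ∀ k ∉ diagIndex p q, kComp k.1 k.2 F = 0) :
    HasSum (fun k : {k : ℕ × ℕ // 2 * k.1 + p = 2 * k.2 + q} =>
      eigval p k.1.1 * ‖kComp k.1.1 k.1.2 F‖ ^ 2) (‖Dp F‖ ^ 2) := by
  have h := hasSum_norm_sq_kComp (Dp F)
  rw [funext (norm_sq_kComp_Dp hF)] at h
  exact hasSum_diagIndex (f := fun k : ℕ × ℕ => eigval p k.1 * ‖kComp k.1 k.2 F‖ ^ 2) h
    fun k hk => by
      rw [h0 k hk, norm_zero, sq, mul_zero, mul_zero]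

end Main

end MinRep

end

/-! ### The main theorem -/

theorem theorem3p9 (p q : ℕ) [Fact (2 ≤ p)] [Fact (2 ≤ q)] (hpq : (p, q) ≠ (2, 2)) :
    (∃ (H : Type) (_ : NormedAddCommGroup H) (_ : InnerProductSpace ℂ H)
        (ι : MinRep.V p q →ₗ[ℂ] H),
        MinRep.IsHilbertCompletion (MinRep.unitaryForm p q) ι) ∧
    ∀ {H : Type*} [NormedAddCommGroup H] [InnerProductSpace ℂ H]
      (ι : MinRep.V p q →ₗ[ℂ] H),
      MinRep.IsHilbertCompletion (MinRep.unitaryForm p q) ι →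
      ∃ j : H →L[ℂ] MinRep.L2M p q,
        (∀ f : MinRep.V p q, j (ι f) = MinRep.toL2 p q f) ∧
        Function.Injective j ∧
        Set.range j =
          {F | F ∈ MinRep.domDp p q ∩ MinRep.domDq p q ∧ MinRep.Dp F = MinRep.Dq F} ∧
        Set.range j =
          {F | F ∈ MinRep.domDp p q ∩ MinRep.domDq p q ∧ MinRep.WeakYamabeZero F} ∧
        ∀ h : H,
          ‖h‖ ^ 2 = 1 / 4 * ‖MinRep.Dp (j h) + MinRep.Dq (j h)‖ ^ 2 ∧
          HasSum (fun ab : {ab : ℕ × ℕ // 2 * ab.1 + p = 2 * ab.2 + q} =>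
            MinRep.kComp ab.1.1 ab.1.2 (j h)) (j h) ∧
          HasSum (fun ab : {ab : ℕ × ℕ // 2 * ab.1 + p = 2 * ab.2 + q} =>
            ((Real.sqrt ((ab.1.1 : ℝ) + ((p : ℝ) - 2) / 2) : ℝ) : ℂ) •
              MinRep.kComp ab.1.1 ab.1.2 (j h)) (MinRep.Dp (j h)) ∧
          HasSum (fun ab : {ab : ℕ × ℕ // 2 * ab.1 + p = 2 * ab.2 + q} =>
            ((ab.1.1 : ℝ) + ((p : ℝ) - 2) / 2) * ‖MinRep.kComp ab.1.1 ab.1.2 (j h)‖ ^ 2)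
            (‖h‖ ^ 2) := by
  refine ⟨MinRep.exists_completion p q, ?_⟩
  intro H _ _ ι hι
  obtain ⟨j, hj, hinj, hprop, hsurj⟩ := MinRep.exists_embedding_completion hpq hι
  refine ⟨j, hj, hinj, ?_, ?_, fun h => ?_⟩
  · ext F
    constructor
    · rintro ⟨h, rfl⟩
      obtain ⟨h0, h1, -⟩ := hprop h
      have h2 := MinRep.mem_domDq_and_Dq_eq h1 h0
      exact ⟨⟨h1, h2.1⟩, h2.2.symm⟩
    · rintro ⟨⟨h1, h2⟩, h3⟩
      exact hsurj F h1 fun k hk => MinRep.kComp_eq_zero_of_Dp_eq_Dq h1 h2 h3 hk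
  · ext F
    constructor
    · rintro ⟨h, rfl⟩
      obtain ⟨h0, h1, -⟩ := hprop h
      exact ⟨⟨h1, (MinRep.mem_domDq_and_Dq_eq h1 h0).1⟩,
        MinRep.weakYamabeZero_of_kComp_eq_zero fun a b hab => h0 (a, b) hab⟩
    · rintro ⟨⟨h1, -⟩, h3⟩
      exact hsurj F h1 fun k hk => MinRep.kComp_eq_zero_of_weakYamabeZero h3 hk
  · obtain ⟨h0, h1, hn⟩ := hprop h
    refine ⟨?_, MinRep.hasSum_diagIndex_kComp h0,
      MinRep.hasSum_diagIndex_Dp h1 h0, ?_⟩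
    · rw [← hn]
      exact MinRep.norm_sq_Dp_eq h1 h0
    · rw [← hn]
      exact MinRep.hasSum_diagIndex_norm_sq h1 h0
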